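/- Let $L$ be a finite-dimensional complex semisimple Lie algebra, with a Cartan subalgebra, a base $\alpha_1,\dots,\alpha_n$ of its root system, Cartan matrix $a_{ij}=\langle\alpha_j,\alpha_i^\vee\rangle$, and integers $d_i\in\{1,2,3\}$ with $d_ia_{ij}=d_ja_{ji}$ for all $i,j$. Let $q\in\mathbb C$ be nonzero and not a root of unity. Let $U_q(L)$ be the $\mathbb C$-algebra generated by $E_i,F_i,K_i,K_i^{-1}$ $(1\le i\le n)$ with the relations $$K_iK_i^{-1}=K_i^{-1}K_i=1,\quad K_iK_j=K_jK_i,\quad K_iE_j=q^{d_ia_{ij}}E_jK_i,\quad K_iF_j=q^{-d_ia_{ij}}F_jK_i,$$ $$E_iF_j-F_jE_i=\delta_{ij}\,\frac{K_i^2-K_i^{-2}}{q^{2d_i}-q^{-2d_i}},$$ $$\sum_{m=0}^{1-a_{ij}}(-1)^m{1-a_{ij}\brack m}_{q^{2d_i}}X_i^{1-a_{ij}-m}X_jX_i^m=0\qquad(i\ne j,\ X=E\text{ or }X=F),$$ where ${r\brack m}_v=\frac{[r]_v!}{[m]_v!\,[r-m]_v!}$, $[r]_v!=[1]_v\cdots[r]_v$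 and $[s]_v=\frac{v^s-v^{-s}}{v-v^{-1}}$. It is a Hopf algebra with $$\Delta(X_i)=X_i\otimes K_i^{-1}+K_i\otimes X_i\ \ (X=E,F),\quad \Delta(K_i)=K_i\otimes K_i,\quad \varepsilon(E_i)=\varepsilon(F_i)=0,\quad \varepsilon(K_i)=1,$$ $$S(E_i)=-q^{-2d_i}E_i,\quad S(F_i)=-q^{2d_i}F_i,\quad S(K_i)=K_i^{-1}.$$ For a group $G$, a quiver $Q$ with vertex set $G$ and arrow set $Q_1$ is a Hopf quiver if, for all $x,y\in G$, the cardinality of the set of arrows from $x$ to $y$ depends only on the conjugacy class of $x^{-1}y$. The space $\mathbb CQ_1$ with basis $Q_1$ is a $\mathbb CG$-bicomodule by $\delta^-(a)=t(a)\otimes a$ and $\delta^+(a)=a\otimes s(a)$, where $s(a)$ and $t(a)$ are the start and end vertices of the arrow $a$. Given a $\mathbb CG$-bimodule structure on $\mathbb CQ_1$ for which $\delta^-$ and $\delta^+$ are bimodule maps (so that $\mathbb CQ_1$ is a $\mathbb CG$-Hopf bimodule), the semi-path Hopf algebra is the tensor algebra $T_{\mathbb CG}(\mathbb CQ_1)$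 with the Hopf algebra structure determined by $\Delta(g)=g\otimes g$ and $\varepsilon(g)=1$ for $g\in G$, and $\Delta(a)=t(a)\otimes a+a\otimes s(a)$ and $\varepsilon(a)=0$ for $a\in Q_1$. Then there are a group $G$, a Hopf quiver $Q$ on $G$, a $\mathbb CG$-Hopf bimodule structure on $\mathbb CQ_1$ with the above coactions, and a Hopf ideal $I$ of the semi-path Hopf algebra $T_{\mathbb CG}(\mathbb CQ_1)$ such that $$U_q(L)\;\cong\;T_{\mathbb CG}(\mathbb CQ_1)/I\qquad\text{as Hopf algebras.}$$ -/

import Mathlib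

open scoped TensorProduct

universe u v

namespace QuiverHopf

section HopfOfGenerators

variable {k A : Type*} [CommRing k] [Ring A] [Bialgebra k A]

/-- The linear map `a ⊗ b ↦ S(a) b` attached to an anti-homomorphism `S`. -/
noncomputable def convLeft (S : A →ₐ[k] Aᵐᵒᵖ) : A ⊗[k] A →ₗ[k] A :=
  LinearMap.mul' k A ∘ₗ
    ((MulOpposite.opLinearEquiv k).symm.toLinearMap ∘ₗ S.toLinearMap).rTensor A

/-- The linear map `a ⊗ b ↦ a S(b)` attached to an anti-homomorphism `S`. -/
noncomputable def convRight (S : A →ₐ[k] Aᵐᵒᵖ) : A ⊗[k] A →ₗ[k] A :=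
  LinearMap.mul' k A ∘ₗ
    ((MulOpposite.opLinearEquiv k).symm.toLinearMap ∘ₗ S.toLinearMap).lTensor A

@[simp] lemma convLeft_tmul (S : A →ₐ[k] Aᵐᵒᵖ) (a b : A) :
    convLeft S (a ⊗ₜ b) = (S a).unop * b := by simp [convLeft]

@[simp] lemma convRight_tmul (S : A →ₐ[k] Aᵐᵒᵖ) (a b : A) :
    convRight S (a ⊗ₜ b) = a * (S b).unop := by simp [convRight]

lemma convLeft_mul_tmul (S : A →ₐ[k] Aᵐᵒᵖ) (x : A ⊗[k] A) (c d : A) :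
    convLeft S (x * c ⊗ₜ d) = (S c).unop * convLeft S x * d := by
  induction x using TensorProduct.induction_on with
  | zero => simp
  | tmul a b => simp [mul_assoc]
  | add x y hx hy => simp [add_mul, mul_add, hx, hy]

lemma convRight_tmul_mul (S : A →ₐ[k] Aᵐᵒᵖ) (x : A ⊗[k] A) (c d : A) :
    convRight S (c ⊗ₜ d * x) = c * convRight S x * (S d).unop := by
  induction x using TensorProduct.induction_on with
  | zero => simp
  | tmul a b => simp [mul_assoc]
  | add x y hx hy => simp [add_mul, mul_add, hx, hy]

lemma convLeft_mul (S : A →ₐ[k] Aᵐᵒᵖ) (x y : A ⊗[k] A) (c : k)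
    (hx : convLeft S x = algebraMap k A c) :
    convLeft S (x * y) = c • convLeft S y := by
  induction y using TensorProduct.induction_on with
  | zero => simp
  | tmul a b =>
    rw [convLeft_mul_tmul, hx, convLeft_tmul, ← Algebra.commutes, Algebra.smul_def, mul_assoc]
  | add x y hx hy => simp [mul_add, hx, hy]

lemma convRight_mul (S : A →ₐ[k] Aᵐᵒᵖ) (x y : A ⊗[k] A) (c : k)
    (hy : convRight S y = algebraMap k A c) :
    convRight S (x * y) = c • convRight S x := by
  induction x using TensorProduct.induction_on with
  | zero => simp
  | tmul a b =>
    rw [convRight_tmul_mul, hy, convRight_tmul, ← Algebra.commutes, Algebra.smul_def, mul_assoc]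
  | add x y hx hy => simp [add_mul, hx, hy]

/-- A bialgebra with an algebra anti-homomorphism that satisfies the antipode axioms on a set of
algebra generators is a Hopf algebra. -/
noncomputable abbrev hopfOfGenerators (S : A →ₐ[k] Aᵐᵒᵖ) (s : Set A)
    (hs : Algebra.adjoin k s = ⊤)
    (hl : ∀ a ∈ s, convLeft S (Coalgebra.comul a) = algebraMap k A (Coalgebra.counit a))
    (hr : ∀ a ∈ s, convRight S (Coalgebra.comul a) = algebraMap k A (Coalgebra.counit a)) :
    HopfAlgebra k A where
  antipode := (MulOpposite.opLinearEquiv k).symm.toLinearMap ∘ₗ S.toLinearMap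
  mul_antipode_rTensor_comul := by
    ext a
    change convLeft S (Coalgebra.comul a) = algebraMap k A (Coalgebra.counit a)
    have ha : a ∈ Algebra.adjoin k s := by rw [hs]; trivial
    induction ha using Algebra.adjoin_induction with
    | mem x hx => exact hl x hx
    | algebraMap r => simp [Algebra.TensorProduct.algebraMap_apply]
    | add x y _ _ hx hy => simp [hx, hy]
    | mul x y _ _ hx hy =>
      rw [Bialgebra.comul_mul, convLeft_mul S _ _ _ hx, hy, Bialgebra.counit_mul, map_mul,
        Algebra.smul_def]
  mul_antipode_lTensor_comul := by
    ext a
    change convRight S (Coalgebra.comul a) = algebraMap k A (Coalgebra.counit a)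
    have ha : a ∈ Algebra.adjoin k s := by rw [hs]; trivial
    induction ha using Algebra.adjoin_induction with
    | mem x hx => exact hr x hx
    | algebraMap r => simp [Algebra.TensorProduct.algebraMap_apply]
    | add x y _ _ hx hy => simp [hx, hy]
    | mul x y _ _ hx hy =>
      rw [Bialgebra.comul_mul, convRight_mul S _ _ _ hy, hx, Bialgebra.counit_mul, map_mul,
        Algebra.smul_def, Algebra.commutes]

end HopfOfGenerators

section BimoduleTensorAlgebra

variable {k B M : Type*} [CommRing k] [Ring B] [Algebra k B] [AddCommGroup M] [Module k M]

open TensorAlgebra MulOpposite in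
/-- The relations that present the tensor algebra of a `B`-bimodule `M`. -/
inductive BimodRel (l : B →ₐ[k] Module.End k M) (r : Bᵐᵒᵖ →ₐ[k] Module.End k M) :
    TensorAlgebra k (B × M) → TensorAlgebra k (B × M) → Prop
  | one : BimodRel l r (ι k (1, 0)) 1
  | mul (a b : B) : BimodRel l r (ι k (a * b, 0)) (ι k (a, 0) * ι k (b, 0))
  | left (a : B) (m : M) : BimodRel l r (ι k (0, l a m)) (ι k (a, 0) * ι k (0, m))
  | right (m : M) (b : B) : BimodRel l r (ι k (0, r (op b) m)) (ι k (0, m) * ι k (b, 0))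

/-- The tensor algebra `T_B(M)` of the `B`-bimodule `M` over the `k`-algebra `B`, where `l` is the
left and `r` the right action. It is the universal `k`-algebra with an algebra map from `B` and a
`B`-bimodule map from `M`; equivalently `B ⊕ M ⊕ (M ⊗_B M) ⊕ ⋯`. -/
def BimodTensor (l : B →ₐ[k] Module.End k M) (r : Bᵐᵒᵖ →ₐ[k] Module.End k M) :=
  RingQuot (BimodRel l r)

namespace BimodTensor

variable (l : B →ₐ[k] Module.End k M) (r : Bᵐᵒᵖ →ₐ[k] Module.End k M)

noncomputable instance : Ring (BimodTensor l r) := inferInstanceAs (Ring (RingQuot _))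

noncomputable instance : Algebra k (BimodTensor l r) :=
  inferInstanceAs (Algebra k (RingQuot _))

/-- The quotient map from the free tensor algebra on `B × M`. -/
noncomputable def mk : TensorAlgebra k (B × M) →ₐ[k] BimodTensor l r :=
  RingQuot.mkAlgHom k (BimodRel l r)

/-- The inclusion of the degree zero part `B`. -/
noncomputable def inclB : B →ₐ[k] BimodTensor l r :=
  AlgHom.ofLinearMap
    ((mk l r).toLinearMap ∘ₗ TensorAlgebra.ι k ∘ₗ LinearMap.inl k B M)
    (by simpa using! RingQuot.mkAlgHom_rel k (BimodRel.one (l := l) (r := r)))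
    (fun a b => by
      simpa using! RingQuot.mkAlgHom_rel k (BimodRel.mul (l := l) (r := r) a b))

/-- The inclusion of the degree one part `M`. -/
noncomputable def inclM : M →ₗ[k] BimodTensor l r :=
  (mk l r).toLinearMap ∘ₗ TensorAlgebra.ι k ∘ₗ LinearMap.inr k B M

lemma inclM_left (a : B) (m : M) : inclM l r (l a m) = inclB l r a * inclM l r m := by
  simpa using! RingQuot.mkAlgHom_rel k (BimodRel.left (l := l) (r := r) a m)

lemma inclM_right (m : M) (b : B) :
    inclM l r (r (MulOpposite.op b) m) = inclM l r m * inclB l r b := by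
  simpa using! RingQuot.mkAlgHom_rel k (BimodRel.right (l := l) (r := r) m b)

variable {l r}
variable {D : Type*} [Ring D] [Algebra k D]

/-- The universal property of the tensor algebra of a bimodule. -/
noncomputable def lift (φ : B →ₐ[k] D) (f : M →ₗ[k] D) (hl : ∀ a m, f (l a m) = φ a * f m)
    (hr : ∀ m b, f (r (MulOpposite.op b) m) = f m * φ b) : BimodTensor l r →ₐ[k] D :=
  RingQuot.liftAlgHom k ⟨TensorAlgebra.lift k (φ.toLinearMap.coprod f), by
    intro x y h
    cases h <;> simp [hl, hr]⟩

@[simp] lemma lift_inclB (φ : B →ₐ[k] D) (f : M →ₗ[k] D) (hl hr) (b : B) :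
    lift (l := l) (r := r) φ f hl hr (inclB l r b) = φ b := by
  have : lift (l := l) (r := r) φ f hl hr (mk l r (TensorAlgebra.ι k (b, 0))) = φ b := by
    unfold lift mk
    erw [RingQuot.liftAlgHom_mkAlgHom_apply]
    simp
  exact this

@[simp] lemma lift_inclM (φ : B →ₐ[k] D) (f : M →ₗ[k] D) (hl hr) (m : M) :
    lift (l := l) (r := r) φ f hl hr (inclM l r m) = f m := by
  have : lift (l := l) (r := r) φ f hl hr (mk l r (TensorAlgebra.ι k (0, m))) = f m := by
    unfold lift mk
    erw [RingQuot.liftAlgHom_mkAlgHom_apply]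
    simp
  exact this

lemma algHom_ext {f g : BimodTensor l r →ₐ[k] D}
    (hB : ∀ b, f (inclB l r b) = g (inclB l r b)) (hM : ∀ m, f (inclM l r m) = g (inclM l r m)) :
    f = g := by
  apply RingQuot.ringQuot_ext'
  apply TensorAlgebra.hom_ext
  apply LinearMap.ext
  rintro ⟨b, m⟩
  have h : ((b, m) : B × M) = (b, 0) + (0, m) := by simp
  rw [h, map_add, map_add]
  exact congrArg₂ (· + ·) (hB b) (hM m)

lemma adjoin_eq_top :
    Algebra.adjoin k (Set.range (inclB l r) ∪ Set.range (inclM l r)) = ⊤ := by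
  rw [eq_top_iff]
  rintro x -
  set S := Algebra.adjoin k (Set.range (inclB l r) ∪ Set.range (inclM l r)) with hS
  have hb : ∀ b, inclB l r b ∈ S := fun b => Algebra.subset_adjoin (Or.inl ⟨b, rfl⟩)
  have hm : ∀ m, inclM l r m ∈ S := fun m => Algebra.subset_adjoin (Or.inr ⟨m, rfl⟩)
  let φ : B →ₐ[k] S := (inclB l r).codRestrict S hb
  let f : M →ₗ[k] S := (inclM l r).codRestrict (Subalgebra.toSubmodule S) hm
  let F : BimodTensor l r →ₐ[k] S := lift φ f
    (fun a m => Subtype.ext (inclM_left l r a m)) (fun m b => Subtype.ext (inclM_right l r m b))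
  have h : S.val.comp F = AlgHom.id k _ := by
    apply algHom_ext <;> intro <;> simp [F, φ, f]
    rfl
  have := congrArg (fun g => g x) h
  simp only [AlgHom.comp_apply, AlgHom.id_apply] at this
  rw [← this]
  exact (F x).2

end BimodTensor

end BimoduleTensorAlgebra

section SemiPath

lemma antipode_of {k G : Type*} [CommRing k] [Group G] (g : G) :
    HopfAlgebra.antipode k (MonoidAlgebra.of k G g) = MonoidAlgebra.of k G g⁻¹ := by
  simp

lemma antipode_mul_of {k G : Type*} [CommRing k] [Group G] (g : G) (x : MonoidAlgebra k G) :
    HopfAlgebra.antipode k (x * MonoidAlgebra.of k G g) =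
      MonoidAlgebra.of k G g⁻¹ * HopfAlgebra.antipode k x := by
  rw [HopfAlgebra.antipode_mul_antidistrib, antipode_of]

lemma antipode_of_mul {k G : Type*} [CommRing k] [Group G] (g : G) (x : MonoidAlgebra k G) :
    HopfAlgebra.antipode k (MonoidAlgebra.of k G g * x) =
      HopfAlgebra.antipode k x * MonoidAlgebra.of k G g⁻¹ := by
  rw [HopfAlgebra.antipode_mul_antidistrib, antipode_of]

/-- To check a `k`-linear identity on `kG` it suffices to check it on `G`. -/
lemma groupAlgebra_ext {k G P : Type*} [CommRing k] [Group G]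
     [AddCommMonoid P] [Module k P] {f f' : MonoidAlgebra k G →ₗ[k] P}
    (h : ∀ g, f (MonoidAlgebra.of k G g) = f' (MonoidAlgebra.of k G g))
    (a : MonoidAlgebra k G) : f a = f' a := by
  induction a using MonoidAlgebra.induction_on with
  | of g => exact h g
  | add a b ha hb => simp [ha, hb]
  | smul c a ha => simp [ha]

/-- A quiver on the vertex set `G` is a Hopf quiver with respect to the ramification `r` (a family
of cardinals indexed by the conjugacy classes of the group `G`) if the number of arrows from `x` to
`y` is `r C`, where `C` is the conjugacy class of `x⁻¹ y`. -/
def IsHopfQuiver (G : Type u) [Group G] [Quiver.{v} G]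
    (r : ConjClasses G → Cardinal.{v}) : Prop :=
  ∀ x y : G, Cardinal.mk (x ⟶ y) = r (ConjClasses.mk (x⁻¹ * y))

/-- The set `Q₁` of all arrows, an arrow being given with its start and its end vertex. -/
abbrev Arrow (G : Type u) [Quiver.{v} G] : Type (max u v) := Σ x : G, Σ y : G, x ⟶ y

/-- The start vertex of an arrow. -/
def Arrow.src {G : Type u} [Quiver.{v} G] (a : Arrow G) : G := a.1

/-- The end vertex of an arrow. -/
def Arrow.tgt {G : Type u} [Quiver.{v} G] (a : Arrow G) : G := a.2.1

variable (k : Type*) [CommRing k] (G : Type u) [Group G] [Quiver.{v} G]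

/-- The vector space `kQ₁` on the set of arrows. -/
abbrev ArrowSpace := Arrow G →₀ k

/-- The left `kG`-coaction `δ⁻(a) = t(a) ⊗ a` of the arrow comodule. -/
noncomputable def arrowCoactL :
    ArrowSpace k G →ₗ[k] MonoidAlgebra k G ⊗[k] ArrowSpace k G :=
  Finsupp.linearCombination k fun a => MonoidAlgebra.of k G a.tgt ⊗ₜ[k] Finsupp.single a 1

/-- The right `kG`-coaction `δ⁺(a) = a ⊗ s(a)` of the arrow comodule. -/
noncomputable def arrowCoactR :
    ArrowSpace k G →ₗ[k] ArrowSpace k G ⊗[k] MonoidAlgebra k G :=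
  Finsupp.linearCombination k fun a => Finsupp.single a 1 ⊗ₜ[k] MonoidAlgebra.of k G a.src

/-- A `kG`-Hopf bimodule structure `(kQ₁, α⁻, α⁺)` on the arrow comodule: a left and a right
`kG`-module structure that commute and for which both coactions are maps of `kG`-bimodules, where
`kG` acts on tensor products through its comultiplication. As `kG` is spanned by the group-like
elements `g ∈ G`, for which `Δ(g) = g ⊗ g`, the last condition is stated for these. -/
structure ArrowHopfBimodule where
  /-- The left `kG`-module structure. -/
  lact : MonoidAlgebra k G →ₐ[k] Module.End k (ArrowSpace k G)
  /-- The right `kG`-module structure. -/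
  ract : (MonoidAlgebra k G)ᵐᵒᵖ →ₐ[k] Module.End k (ArrowSpace k G)
  lact_ract : ∀ a b m, lact a (ract b m) = ract b (lact a m)
  coactL_lact : ∀ (g : G) m, arrowCoactL k G (lact (MonoidAlgebra.of k G g) m) =
    TensorProduct.map (LinearMap.mulLeft k (MonoidAlgebra.of k G g))
      (lact (MonoidAlgebra.of k G g)) (arrowCoactL k G m)
  coactL_ract : ∀ (g : G) m,
    arrowCoactL k G (ract (MulOpposite.op (MonoidAlgebra.of k G g)) m) =
    TensorProduct.map (LinearMap.mulRight k (MonoidAlgebra.of k G g))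
      (ract (MulOpposite.op (MonoidAlgebra.of k G g))) (arrowCoactL k G m)
  coactR_lact : ∀ (g : G) m, arrowCoactR k G (lact (MonoidAlgebra.of k G g) m) =
    TensorProduct.map (lact (MonoidAlgebra.of k G g))
      (LinearMap.mulLeft k (MonoidAlgebra.of k G g)) (arrowCoactR k G m)
  coactR_ract : ∀ (g : G) m,
    arrowCoactR k G (ract (MulOpposite.op (MonoidAlgebra.of k G g)) m) =
    TensorProduct.map (ract (MulOpposite.op (MonoidAlgebra.of k G g)))
      (LinearMap.mulRight k (MonoidAlgebra.of k G g)) (arrowCoactR k G m)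

variable {k G}

/-- The semi-path Hopf algebra `kQˢ(α⁻, α⁺) = T_{kG}(kQ₁)`, the tensor algebra of the `kG`-bimodule
`kQ₁`. Its Hopf algebra structure is constructed below: `Δ(g) = g ⊗ g` for `g ∈ G` and
`Δ(a) = t(a) ⊗ a + a ⊗ s(a)` for an arrow `a`. -/
abbrev SemiPath (N : ArrowHopfBimodule k G) := BimodTensor N.lact N.ract

namespace SemiPath

open MulOpposite

variable (N : ArrowHopfBimodule k G)

/-- The inclusion of `kG`. -/
noncomputable abbrev inclG : MonoidAlgebra k G →ₐ[k] SemiPath N := BimodTensor.inclB N.lact N.ract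

/-- The inclusion of `kQ₁`. -/
noncomputable abbrev inclArrow : ArrowSpace k G →ₗ[k] SemiPath N :=
  BimodTensor.inclM N.lact N.ract

/-- The comultiplication on the degree one part, `Δ = δ⁻ + δ⁺`. -/
noncomputable def comulArrow : ArrowSpace k G →ₗ[k] SemiPath N ⊗[k] SemiPath N :=
  TensorProduct.map (inclG N).toLinearMap (inclArrow N) ∘ₗ arrowCoactL k G +
    TensorProduct.map (inclArrow N) (inclG N).toLinearMap ∘ₗ arrowCoactR k G

/-- The comultiplication on the degree zero part, that of `kG`. -/
noncomputable def comulG : MonoidAlgebra k G →ₐ[k] SemiPath N ⊗[k] SemiPath N :=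
  (Algebra.TensorProduct.map (inclG N) (inclG N)).comp (Bialgebra.comulAlgHom k _)

@[simp] lemma comulG_of (g : G) : comulG N (MonoidAlgebra.of k G g) =
    inclG N (MonoidAlgebra.of k G g) ⊗ₜ inclG N (MonoidAlgebra.of k G g) := by
  simp [comulG]

lemma comulArrow_single (a : Arrow G) : comulArrow N (Finsupp.single a 1) =
    inclG N (MonoidAlgebra.of k G a.tgt) ⊗ₜ inclArrow N (Finsupp.single a 1) +
    inclArrow N (Finsupp.single a 1) ⊗ₜ inclG N (MonoidAlgebra.of k G a.src) := by
  simp [comulArrow, arrowCoactL, arrowCoactR]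

lemma comulArrow_left (a : MonoidAlgebra k G) (m : ArrowSpace k G) :
    comulArrow N (N.lact a m) = comulG N a * comulArrow N m := by
  refine groupAlgebra_ext (f := comulArrow N ∘ₗ LinearMap.flip N.lact.toLinearMap m)
    (f' := LinearMap.mulRight k (comulArrow N m) ∘ₗ (comulG N).toLinearMap) (fun g => ?_) a
  have h1 : ∀ t : MonoidAlgebra k G ⊗[k] ArrowSpace k G,
      TensorProduct.map (inclG N).toLinearMap (inclArrow N)
        (TensorProduct.map (LinearMap.mulLeft k (MonoidAlgebra.of k G g))
          (N.lact (MonoidAlgebra.of k G g)) t) =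
      (comulG N (MonoidAlgebra.of k G g)) *
        TensorProduct.map (inclG N).toLinearMap (inclArrow N) t := by
    intro t
    rw [comulG_of]
    induction t using TensorProduct.induction_on with
    | zero => simp
    | tmul x y => simp [BimodTensor.inclM_left, -MonoidAlgebra.of_apply]
    | add x y hx hy => simp only [map_add, hx, hy, mul_add]
  have h2 : ∀ t : ArrowSpace k G ⊗[k] MonoidAlgebra k G,
      TensorProduct.map (inclArrow N) (inclG N).toLinearMap
        (TensorProduct.map (N.lact (MonoidAlgebra.of k G g))
          (LinearMap.mulLeft k (MonoidAlgebra.of k G g)) t) =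
      (comulG N (MonoidAlgebra.of k G g)) *
        TensorProduct.map (inclArrow N) (inclG N).toLinearMap t := by
    intro t
    rw [comulG_of]
    induction t using TensorProduct.induction_on with
    | zero => simp
    | tmul x y => simp [BimodTensor.inclM_left, -MonoidAlgebra.of_apply]
    | add x y hx hy => simp only [map_add, hx, hy, mul_add]
  have e : comulArrow N (N.lact (MonoidAlgebra.of k G g) m) =
      comulG N (MonoidAlgebra.of k G g) * comulArrow N m := by
    simp only [comulArrow, LinearMap.add_apply, LinearMap.comp_apply, N.coactL_lact,
      N.coactR_lact, h1, h2, mul_add]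
  exact e

lemma comulArrow_right (m : ArrowSpace k G) (a : MonoidAlgebra k G) :
    comulArrow N (N.ract (op a) m) = comulArrow N m * comulG N a := by
  refine groupAlgebra_ext (f := comulArrow N ∘ₗ LinearMap.flip N.ract.toLinearMap m ∘ₗ
      (opLinearEquiv k).toLinearMap)
    (f' := LinearMap.mulLeft k (comulArrow N m) ∘ₗ (comulG N).toLinearMap) (fun g => ?_) a
  have h1 : ∀ t : MonoidAlgebra k G ⊗[k] ArrowSpace k G,
      TensorProduct.map (inclG N).toLinearMap (inclArrow N)
        (TensorProduct.map (LinearMap.mulRight k (MonoidAlgebra.of k G g))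
          (N.ract (op (MonoidAlgebra.of k G g))) t) =
      TensorProduct.map (inclG N).toLinearMap (inclArrow N) t *
        (comulG N (MonoidAlgebra.of k G g)) := by
    intro t
    rw [comulG_of]
    induction t using TensorProduct.induction_on with
    | zero => simp
    | tmul x y => simp [BimodTensor.inclM_right, -MonoidAlgebra.of_apply]
    | add x y hx hy => simp only [map_add, hx, hy, add_mul]
  have h2 : ∀ t : ArrowSpace k G ⊗[k] MonoidAlgebra k G,
      TensorProduct.map (inclArrow N) (inclG N).toLinearMap
        (TensorProduct.map (N.ract (op (MonoidAlgebra.of k G g)))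
          (LinearMap.mulRight k (MonoidAlgebra.of k G g)) t) =
      TensorProduct.map (inclArrow N) (inclG N).toLinearMap t *
        (comulG N (MonoidAlgebra.of k G g)) := by
    intro t
    rw [comulG_of]
    induction t using TensorProduct.induction_on with
    | zero => simp
    | tmul x y => simp [BimodTensor.inclM_right, -MonoidAlgebra.of_apply]
    | add x y hx hy => simp only [map_add, hx, hy, add_mul]
  have e : comulArrow N (N.ract (op (MonoidAlgebra.of k G g)) m) =
      comulArrow N m * comulG N (MonoidAlgebra.of k G g) := by
    simp only [comulArrow, LinearMap.add_apply, LinearMap.comp_apply, N.coactL_ract,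
      N.coactR_ract, h1, h2, add_mul]
  exact e

/-- The comultiplication: on `kG` that of `kG`, on `kQ₁` the sum `δ⁻ + δ⁺`. -/
noncomputable def comulHom : SemiPath N →ₐ[k] SemiPath N ⊗[k] SemiPath N :=
  BimodTensor.lift (comulG N) (comulArrow N) (comulArrow_left N) (comulArrow_right N)

/-- The counit: on `kG` that of `kG`, on `kQ₁` zero. -/
noncomputable def counitHom : SemiPath N →ₐ[k] k :=
  BimodTensor.lift (Bialgebra.counitAlgHom k (MonoidAlgebra k G)) 0 (by simp) (by simp)

/-- Two algebra maps on `T_{kG}(kQ₁)` agree if they do on vertices and arrows. -/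
lemma algHom_ext' {D : Type*} [Ring D] [Algebra k D] {f f' : SemiPath N →ₐ[k] D}
    (hG : ∀ g : G, f (inclG N (MonoidAlgebra.of k G g)) = f' (inclG N (MonoidAlgebra.of k G g)))
    (hA : ∀ a : Arrow G,
      f (inclArrow N (Finsupp.single a 1)) = f' (inclArrow N (Finsupp.single a 1))) : f = f' := by
  apply BimodTensor.algHom_ext
  · exact groupAlgebra_ext (f := f.toLinearMap ∘ₗ (inclG N).toLinearMap)
      (f' := f'.toLinearMap ∘ₗ (inclG N).toLinearMap) hG
  · intro m
    have : f.toLinearMap ∘ₗ inclArrow N = f'.toLinearMap ∘ₗ inclArrow N := by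
      apply Finsupp.lhom_ext'
      intro a
      apply LinearMap.ext_ring
      exact hA a
    exact congrArg (fun F => F m) this

@[simp] lemma comulHom_of (g : G) : comulHom N (inclG N (MonoidAlgebra.of k G g)) =
    inclG N (MonoidAlgebra.of k G g) ⊗ₜ inclG N (MonoidAlgebra.of k G g) := by
  rw [comulHom, BimodTensor.lift_inclB, comulG_of]

@[simp] lemma comulHom_arrow (a : Arrow G) : comulHom N (inclArrow N (Finsupp.single a 1)) =
    inclG N (MonoidAlgebra.of k G a.tgt) ⊗ₜ inclArrow N (Finsupp.single a 1) +
    inclArrow N (Finsupp.single a 1) ⊗ₜ inclG N (MonoidAlgebra.of k G a.src) := by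
  rw [comulHom, BimodTensor.lift_inclM, comulArrow_single]

@[simp] lemma counitHom_of (g : G) : counitHom N (inclG N (MonoidAlgebra.of k G g)) = 1 := by
  rw [counitHom, BimodTensor.lift_inclB]; simp

@[simp] lemma counitHom_arrow (m : ArrowSpace k G) : counitHom N (inclArrow N m) = 0 := by
  rw [counitHom, BimodTensor.lift_inclM]; simp

noncomputable instance : Bialgebra k (SemiPath N) :=
  Bialgebra.ofAlgHom (comulHom N) (counitHom N)
    (by
      apply algHom_ext' <;> intro a <;>
        simp [-MonoidAlgebra.of_apply, TensorProduct.tmul_add, TensorProduct.add_tmul, add_assoc])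
    (by apply algHom_ext' <;> intro a <;> simp [-MonoidAlgebra.of_apply])
    (by apply algHom_ext' <;> intro a <;> simp [-MonoidAlgebra.of_apply])

/-- The linear map `h ⊗ m ⊗ h' ↦ S(h) m S(h')`. -/
noncomputable def antipodeAux :
    MonoidAlgebra k G ⊗[k] (ArrowSpace k G ⊗[k] MonoidAlgebra k G) →ₗ[k] SemiPath N :=
  LinearMap.mul' k (SemiPath N) ∘ₗ TensorProduct.map
    ((inclG N).toLinearMap ∘ₗ HopfAlgebra.antipode k)
    (LinearMap.mul' k (SemiPath N) ∘ₗ TensorProduct.map (inclArrow N)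
      ((inclG N).toLinearMap ∘ₗ HopfAlgebra.antipode k))

/-- The antipode on the degree one part, `S(m) = - ∑ S(m₍₋₁₎) m₍₀₎ S(m₍₁₎)`. -/
noncomputable def antipodeArrow : ArrowSpace k G →ₗ[k] SemiPath N :=
  - (antipodeAux N ∘ₗ (arrowCoactR k G).lTensor _ ∘ₗ arrowCoactL k G)

/-- The antipode on the degree zero part, that of `kG`. -/
noncomputable def antipodeG : MonoidAlgebra k G →ₐ[k] (SemiPath N)ᵐᵒᵖ :=
  MonoidAlgebra.lift k _ G
    { toFun := fun g => op (inclG N (MonoidAlgebra.of k G g⁻¹))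
      map_one' := by simp [-MonoidAlgebra.of_apply]
      map_mul' := fun g h => by simp only [mul_inv_rev, map_mul, op_mul] }

@[simp] lemma antipodeG_of (g : G) : antipodeG N (MonoidAlgebra.of k G g) =
    op (inclG N (MonoidAlgebra.of k G g⁻¹)) := by
  rw [antipodeG, MonoidAlgebra.lift_of]; rfl

lemma inclG_inv_mul (g : G) : inclG N (MonoidAlgebra.of k G g⁻¹) *
    inclG N (MonoidAlgebra.of k G g) = 1 := by
  rw [← map_mul, ← map_mul, inv_mul_cancel, map_one, map_one]

lemma inclG_mul_inv (g : G) : inclG N (MonoidAlgebra.of k G g) *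
    inclG N (MonoidAlgebra.of k G g⁻¹) = 1 := by
  rw [← map_mul, ← map_mul, mul_inv_cancel, map_one, map_one]

lemma inclG_inv_mul_cancel (g : G) (x : SemiPath N) : inclG N (MonoidAlgebra.of k G g⁻¹) *
    (inclG N (MonoidAlgebra.of k G g) * x) = x := by
  rw [← mul_assoc, inclG_inv_mul, one_mul]

lemma inclG_mul_inv_cancel (g : G) (x : SemiPath N) : inclG N (MonoidAlgebra.of k G g) *
    (inclG N (MonoidAlgebra.of k G g⁻¹) * x) = x := by
  rw [← mul_assoc, inclG_mul_inv, one_mul]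

lemma antipodeArrow_left (a : MonoidAlgebra k G) (m : ArrowSpace k G) :
    op (antipodeArrow N (N.lact a m)) = antipodeG N a * op (antipodeArrow N m) := by
  refine groupAlgebra_ext (f := (opLinearEquiv k).toLinearMap ∘ₗ antipodeArrow N ∘ₗ
      LinearMap.flip N.lact.toLinearMap m)
    (f' := LinearMap.mulRight k (op (antipodeArrow N m)) ∘ₗ (antipodeG N).toLinearMap)
    (fun g => ?_) a
  have h1 : ∀ (x : MonoidAlgebra k G) (t : ArrowSpace k G ⊗[k] MonoidAlgebra k G),
      antipodeAux N ((MonoidAlgebra.of k G g * x) ⊗ₜ[k]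
        (TensorProduct.map (N.lact (MonoidAlgebra.of k G g))
          (LinearMap.mulLeft k (MonoidAlgebra.of k G g)) t)) =
      antipodeAux N (x ⊗ₜ[k] t) * inclG N (MonoidAlgebra.of k G g⁻¹) := by
    intro x t
    induction t using TensorProduct.induction_on with
    | zero => simp
    | tmul m y =>
      simp [antipodeAux, BimodTensor.inclM_left, antipode_of_mul, mul_assoc,
        inclG_inv_mul_cancel, -MonoidAlgebra.of_apply]
    | add t t' h h' => simp only [map_add, h, h', TensorProduct.tmul_add, add_mul]
  have h2 : ∀ t : MonoidAlgebra k G ⊗[k] ArrowSpace k G,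
      antipodeAux N ((arrowCoactR k G).lTensor _
        (TensorProduct.map (LinearMap.mulLeft k (MonoidAlgebra.of k G g))
          (N.lact (MonoidAlgebra.of k G g)) t)) =
      antipodeAux N ((arrowCoactR k G).lTensor _ t) * inclG N (MonoidAlgebra.of k G g⁻¹) := by
    intro t
    induction t using TensorProduct.induction_on with
    | zero => simp
    | tmul x m =>
      simp only [TensorProduct.map_tmul, LinearMap.lTensor_tmul, N.coactR_lact,
        LinearMap.mulLeft_apply, h1]
    | add t t' h h' => simp only [map_add, h, h', add_mul]
  have e : op (antipodeArrow N (N.lact (MonoidAlgebra.of k G g) m)) =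
      antipodeG N (MonoidAlgebra.of k G g) * op (antipodeArrow N m) := by
    rw [antipodeG_of, ← op_mul]
    simp only [antipodeArrow, LinearMap.neg_apply, LinearMap.comp_apply, N.coactL_lact, h2,
      neg_mul]
  exact e

lemma antipodeArrow_right (m : ArrowSpace k G) (a : MonoidAlgebra k G) :
    op (antipodeArrow N (N.ract (op a) m)) = op (antipodeArrow N m) * antipodeG N a := by
  refine groupAlgebra_ext (f := (opLinearEquiv k).toLinearMap ∘ₗ antipodeArrow N ∘ₗ
      LinearMap.flip N.ract.toLinearMap m ∘ₗ (opLinearEquiv k).toLinearMap)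
    (f' := LinearMap.mulLeft k (op (antipodeArrow N m)) ∘ₗ (antipodeG N).toLinearMap)
    (fun g => ?_) a
  have h1 : ∀ (x : MonoidAlgebra k G) (t : ArrowSpace k G ⊗[k] MonoidAlgebra k G),
      antipodeAux N ((x * MonoidAlgebra.of k G g) ⊗ₜ[k]
        (TensorProduct.map (N.ract (op (MonoidAlgebra.of k G g)))
          (LinearMap.mulRight k (MonoidAlgebra.of k G g)) t)) =
      inclG N (MonoidAlgebra.of k G g⁻¹) * antipodeAux N (x ⊗ₜ[k] t) := by
    intro x t
    induction t using TensorProduct.induction_on with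
    | zero => simp
    | tmul m y =>
      simp [antipodeAux, BimodTensor.inclM_right, antipode_mul_of, mul_assoc,
        inclG_mul_inv_cancel, -MonoidAlgebra.of_apply]
    | add t t' h h' => simp only [map_add, h, h', TensorProduct.tmul_add, mul_add]
  have h2 : ∀ t : MonoidAlgebra k G ⊗[k] ArrowSpace k G,
      antipodeAux N ((arrowCoactR k G).lTensor _
        (TensorProduct.map (LinearMap.mulRight k (MonoidAlgebra.of k G g))
          (N.ract (op (MonoidAlgebra.of k G g))) t)) =
      inclG N (MonoidAlgebra.of k G g⁻¹) * antipodeAux N ((arrowCoactR k G).lTensor _ t) := by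
    intro t
    induction t using TensorProduct.induction_on with
    | zero => simp
    | tmul x m =>
      simp only [TensorProduct.map_tmul, LinearMap.lTensor_tmul, N.coactR_ract,
        LinearMap.mulRight_apply, h1]
    | add t t' h h' => simp only [map_add, h, h', mul_add]
  have e : op (antipodeArrow N (N.ract (op (MonoidAlgebra.of k G g)) m)) =
      op (antipodeArrow N m) * antipodeG N (MonoidAlgebra.of k G g) := by
    rw [antipodeG_of, ← op_mul]
    simp only [antipodeArrow, LinearMap.neg_apply, LinearMap.comp_apply, N.coactL_ract, h2,
      mul_neg]
  exact e

/-- The antipode as an algebra anti-homomorphism. -/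
noncomputable def antipodeHom : SemiPath N →ₐ[k] (SemiPath N)ᵐᵒᵖ :=
  BimodTensor.lift (antipodeG N) ((opLinearEquiv k).toLinearMap ∘ₗ antipodeArrow N)
    (fun a m => by simpa using! antipodeArrow_left N a m)
    (fun m a => by simpa using! antipodeArrow_right N m a)

@[simp] lemma antipodeHom_of (g : G) : antipodeHom N (inclG N (MonoidAlgebra.of k G g)) =
    op (inclG N (MonoidAlgebra.of k G g⁻¹)) := by
  rw [antipodeHom, BimodTensor.lift_inclB, antipodeG_of]

@[simp] lemma antipodeHom_arrow (a : Arrow G) :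
    antipodeHom N (inclArrow N (Finsupp.single a 1)) =
      op (-(inclG N (MonoidAlgebra.of k G a.tgt⁻¹) * (inclArrow N (Finsupp.single a 1) *
        inclG N (MonoidAlgebra.of k G a.src⁻¹)))) := by
  rw [antipodeHom, BimodTensor.lift_inclM]
  simp only [LinearMap.comp_apply, antipodeArrow, arrowCoactL, arrowCoactR, LinearMap.neg_apply,
    Finsupp.linearCombination_single, one_smul, LinearMap.lTensor_tmul, antipodeAux,
    TensorProduct.map_tmul, LinearMap.mul'_apply, antipode_of]
  rfl

/-- The elements `g ∈ G` and the arrows generate the semi-path algebra. -/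
lemma adjoin_eq_top : Algebra.adjoin k
    (Set.range (fun g : G => inclG N (MonoidAlgebra.of k G g)) ∪
      Set.range (fun a : Arrow G => inclArrow N (Finsupp.single a 1))) = ⊤ := by
  rw [eq_top_iff, ← BimodTensor.adjoin_eq_top, Algebra.adjoin_le_iff]
  rintro _ (⟨b, rfl⟩ | ⟨m, rfl⟩)
  · induction b using MonoidAlgebra.induction_on with
    | of g => exact Algebra.subset_adjoin (Or.inl ⟨g, rfl⟩)
    | add a b ha hb => rw [map_add]; exact add_mem ha hb
    | smul c a ha => rw [map_smul]; exact Subalgebra.smul_mem _ ha c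
  · induction m using Finsupp.induction_linear with
    | zero => rw [map_zero]; exact zero_mem _
    | add a b ha hb => rw [map_add]; exact add_mem ha hb
    | single a c =>
      have : Finsupp.single a c = c • Finsupp.single a (1 : k) := by simp
      rw [this, map_smul]
      refine Subalgebra.smul_mem _ ?_ c
      exact Algebra.subset_adjoin (Or.inr ⟨a, rfl⟩)

lemma comul_of (g : G) :
    Coalgebra.comul (R := k) (inclG N (MonoidAlgebra.of k G g)) =
      inclG N (MonoidAlgebra.of k G g) ⊗ₜ inclG N (MonoidAlgebra.of k G g) :=
  comulHom_of N g

lemma comul_arrow (a : Arrow G) :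
    Coalgebra.comul (R := k) (inclArrow N (Finsupp.single a 1)) =
      inclG N (MonoidAlgebra.of k G a.tgt) ⊗ₜ inclArrow N (Finsupp.single a 1) +
      inclArrow N (Finsupp.single a 1) ⊗ₜ inclG N (MonoidAlgebra.of k G a.src) :=
  comulHom_arrow N a

lemma counit_of (g : G) : Coalgebra.counit (R := k) (inclG N (MonoidAlgebra.of k G g)) = 1 :=
  counitHom_of N g

lemma counit_arrow (m : ArrowSpace k G) : Coalgebra.counit (R := k) (inclArrow N m) = 0 :=
  counitHom_arrow N m

noncomputable instance : HopfAlgebra k (SemiPath N) :=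
  hopfOfGenerators (antipodeHom N) _ (adjoin_eq_top N)
    (by
      rintro _ (⟨g, rfl⟩ | ⟨a, rfl⟩)
      · simp only [comul_of, counit_of, convLeft_tmul, antipodeHom_of, unop_op, inclG_inv_mul,
          map_one]
      · simp only [comul_arrow, counit_arrow, map_add, convLeft_tmul, antipodeHom_of,
          antipodeHom_arrow, unop_op, map_zero, neg_mul, mul_assoc, inclG_inv_mul, mul_one]
        exact add_neg_cancel _)
    (by
      rintro _ (⟨g, rfl⟩ | ⟨a, rfl⟩)
      · simp only [comul_of, counit_of, convRight_tmul, antipodeHom_of, unop_op, inclG_mul_inv,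
          map_one]
      · simp only [comul_arrow, counit_arrow, map_add, convRight_tmul, antipodeHom_of,
          antipodeHom_arrow, unop_op, map_zero, mul_neg, inclG_mul_inv_cancel]
        exact neg_add_cancel _)

end SemiPath

end SemiPath

section QuantumCombinatorics

variable {k : Type*} [Field k]

/-- The symmetric quantum integer `[n]_v = (vⁿ - v⁻ⁿ) / (v - v⁻¹)`. -/
def qInt (v : k) (n : ℕ) : k := (v ^ n - v⁻¹ ^ n) / (v - v⁻¹)

/-- The quantum factorial `[n]_v! = [1]_v [2]_v ⋯ [n]_v`. -/
def qFactorial (v : k) (n : ℕ) : k := ∏ i ∈ Finset.range n, qInt v (i + 1)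

/-- The quantum binomial coefficient `[n]_v! / ([m]_v! [n - m]_v!)`, used for `m ≤ n`. -/
def qBinom (v : k) (n m : ℕ) : k :=
  qFactorial v n / (qFactorial v m * qFactorial v (n - m))

/-- The quantum Serre expression `∑ (-1)^m [r choose m]_v x^(r-m) y x^m`, summed over
`0 ≤ m ≤ r`. -/
def qSerre {R : Type*} [Ring R] [Algebra k R] (v : k) (r : ℕ) (x y : R) : R :=
  ∑ m ∈ Finset.range (r + 1), ((-1) ^ m * qBinom v r m) • (x ^ (r - m) * y * x ^ m)

/-- The quantum binomial coefficients through the Pascal recursion. -/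
def qPascal (v : k) : ℕ → ℕ → k
  | _, 0 => 1
  | 0, _ + 1 => 0
  | n + 1, m + 1 => v⁻¹ ^ (m + 1) * qPascal v n (m + 1) + v ^ n * v⁻¹ ^ m * qPascal v n m

lemma qPascal_eq_zero (v : k) : ∀ {n m : ℕ}, n < m → qPascal v n m = 0
  | 0, 0, h => absurd h (lt_irrefl 0)
  | _ + 1, 0, h => absurd h (by omega)
  | 0, m + 1, _ => by simp [qPascal]
  | n + 1, m + 1, h => by
    simp [qPascal, qPascal_eq_zero v (show n < m + 1 by omega),
      qPascal_eq_zero v (show n < m by omega)]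

lemma qFactorial_succ (v : k) (n : ℕ) :
    qFactorial v (n + 1) = qFactorial v n * qInt v (n + 1) := by
  simp [qFactorial, Finset.prod_range_succ]

lemma qInt_add (v : k) (hv : v ≠ 0) (a b : ℕ) :
    qInt v (a + b) = v⁻¹ ^ b * qInt v a + v ^ a * qInt v b := by
  unfold qInt
  have h : v ^ b * v⁻¹ ^ b = 1 := by rw [← mul_pow, mul_inv_cancel₀ hv, one_pow]
  rw [mul_div_assoc', mul_div_assoc', ← add_div]
  congr 1
  rw [pow_add, pow_add]
  ring

lemma qPascal_mul (v : k) (hv : v ≠ 0) : ∀ n m : ℕ,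
    qPascal v (n + m) m * (qFactorial v m * qFactorial v n) = qFactorial v (n + m)
  | n, 0 => by simp [qPascal, qFactorial]
  | 0, m + 1 => by
    have h := qPascal_mul v hv 0 m
    simp only [zero_add] at h ⊢
    rw [qPascal, qPascal_eq_zero v (Nat.lt_succ_self m), qFactorial_succ]
    have h2 : v ^ m * v⁻¹ ^ m = 1 := by rw [← mul_pow, mul_inv_cancel₀ hv, one_pow]
    rw [h2]
    linear_combination qInt v (m + 1) * h
  | n + 1, m + 1 => by
    have h1 := qPascal_mul v hv n (m + 1)
    have h2 := qPascal_mul v hv (n + 1) m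
    have e1 : n + 1 + (m + 1) = (n + m + 1) + 1 := by ring
    rw [e1, qPascal]
    have e2 : n + (m + 1) = n + m + 1 := by ring
    have e3 : n + 1 + m = n + m + 1 := by ring
    rw [e2] at h1
    rw [e3] at h2
    rw [qFactorial_succ v (n + m + 1)]
    have h3 : v ^ m * v⁻¹ ^ m = 1 := by rw [← mul_pow, mul_inv_cancel₀ hv, one_pow]
    have h4 : v ^ (n + m + 1) * v⁻¹ ^ m = v ^ (n + 1) := by
      rw [show n + m + 1 = (n + 1) + m by ring, pow_add, mul_assoc, h3, mul_one]
    have h5 := qInt_add v hv (n + 1) (m + 1)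
    rw [show n + 1 + (m + 1) = n + m + 1 + 1 by ring] at h5
    rw [h4, h5]
    rw [qFactorial_succ v n, qFactorial_succ v m] at *
    linear_combination (v⁻¹ ^ (m + 1) * qInt v (n + 1)) * h1 +
      (v ^ (n + 1) * qInt v (m + 1)) * h2

lemma qInt_ne_zero (v : k) (hv : v ≠ 0) (h : ∀ n : ℕ, 0 < n → v ^ n ≠ 1) (n : ℕ) :
    qInt v (n + 1) ≠ 0 := by
  have key : ∀ m : ℕ, v ^ (m + 1) - v⁻¹ ^ (m + 1) ≠ 0 := by
    intro m hm
    have h2 : v ^ (m + 1) * v⁻¹ ^ (m + 1) = 1 := by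
      rw [← mul_pow, mul_inv_cancel₀ hv, one_pow]
    apply h ((m + 1) + (m + 1)) (by omega)
    rw [pow_add]
    linear_combination v ^ (m + 1) * hm + h2
  refine div_ne_zero (key n) ?_
  simpa using key 0

lemma qFactorial_ne_zero (v : k) (hv : v ≠ 0) (h : ∀ n : ℕ, 0 < n → v ^ n ≠ 1) (n : ℕ) :
    qFactorial v n ≠ 0 :=
  Finset.prod_ne_zero_iff.2 fun i _ => qInt_ne_zero v hv h i

lemma qBinom_eq_qPascal (v : k) (hv : v ≠ 0) (h : ∀ n : ℕ, 0 < n → v ^ n ≠ 1) {n m : ℕ}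
    (hm : m ≤ n) : qBinom v n m = qPascal v n m := by
  obtain ⟨l, rfl⟩ := Nat.exists_eq_add_of_le' hm
  rw [qBinom, Nat.add_sub_cancel, ← qPascal_mul v hv]
  exact mul_div_cancel_right₀ _
    (mul_ne_zero (qFactorial_ne_zero v hv h _) (qFactorial_ne_zero v hv h _))

lemma qInt_inv (v : k) (n : ℕ) : qInt v⁻¹ n = qInt v n := by
  unfold qInt
  rw [inv_inv, ← neg_sub (v ^ n), ← neg_sub v, neg_div_neg_eq]

lemma qBinom_inv (v : k) (n m : ℕ) : qBinom v⁻¹ n m = qBinom v n m := by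
  simp [qBinom, qFactorial, qInt_inv]

lemma qBinom_symm (v : k) {n m : ℕ} (h : m ≤ n) : qBinom v n (n - m) = qBinom v n m := by
  rw [qBinom, qBinom, Nat.sub_sub_self h, mul_comm (qFactorial v (n - m))]

variable {R : Type*} [Ring R] [Algebra k R]

lemma qSerre_inv (v : k) (r : ℕ) (x y : R) : qSerre v⁻¹ r x y = qSerre v r x y := by
  simp [qSerre, qBinom_inv]

/-- Iterated quantum commutators. -/
def qIter (v b : k) (x y : R) : ℕ → R
  | 0 => y
  | n + 1 => x * qIter v b x y n - (b * v ^ (2 * n)) • (qIter v b x y n * x)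

lemma qIter_eq_sum (v c : k) (hv : v ≠ 0) (x y : R) (n : ℕ) :
    qIter v (c * v) x y n = ∑ m ∈ Finset.range (n + 1),
      ((-1) ^ m * qPascal v n m * (c * v ^ n) ^ m) • (x ^ (n - m) * y * x ^ m) := by
  induction n with
  | zero => simp [qIter, qPascal]
  | succ n ih =>
    rw [qIter, ih, Finset.mul_sum, Finset.sum_mul, Finset.smul_sum, Finset.sum_range_succ',
      Finset.sum_range_succ' _ (n + 1)]
    have hx : ∑ m ∈ Finset.range n, x * (((-1) ^ (m + 1) * qPascal v n (m + 1) *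
        (c * v ^ n) ^ (m + 1)) • (x ^ (n - (m + 1)) * y * x ^ (m + 1))) =
        ∑ m ∈ Finset.range (n + 1), ((-1) ^ (m + 1) * qPascal v n (m + 1) *
        (c * v ^ n) ^ (m + 1)) • (x ^ (n - m) * y * x ^ (m + 1)) := by
      rw [Finset.sum_range_succ, qPascal_eq_zero v (Nat.lt_succ_self n)]
      simp only [mul_zero, zero_mul, zero_smul, add_zero]
      refine Finset.sum_congr rfl fun m hm => ?_
      have hm' := Finset.mem_range.1 hm
      rw [mul_smul_comm, show n - m = (n - (m + 1)) + 1 by omega, pow_succ' x (n - (m + 1))]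
      simp only [mul_assoc]
    rw [hx, add_sub_right_comm, ← Finset.sum_sub_distrib]
    congr 1
    · refine Finset.sum_congr rfl fun m hm => ?_
      rw [smul_mul_assoc, smul_smul, Nat.add_sub_add_right, mul_assoc _ (x ^ m) x, ← pow_succ,
        ← sub_smul]
      congr 1
      rw [qPascal]
      have h3 : ∀ l : ℕ, v ^ l * v⁻¹ ^ l = 1 := fun l => by
        rw [← mul_pow, mul_inv_cancel₀ hv, one_pow]
      have e1 : (c * v ^ (n + 1)) ^ (m + 1) = (c * v ^ n) ^ (m + 1) * v ^ (m + 1) := by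
        rw [pow_succ v n, ← mul_assoc, mul_pow]
      have e2 : (c * v ^ (n + 1)) ^ (m + 1) * (v ^ n * v⁻¹ ^ m) =
          c * v * v ^ (2 * n) * (c * v ^ n) ^ m := by
        rw [e1, pow_succ v m, pow_succ (c * v ^ n) m]
        have := h3 m
        linear_combination (c * v * v ^ (2 * n) * (c * v ^ n) ^ m) * this
      have e3 := h3 (m + 1)
      have e4 : (c * v ^ (n + 1)) ^ (m + 1) * v⁻¹ ^ (m + 1) = (c * v ^ n) ^ (m + 1) := by
        rw [e1, mul_assoc, e3, mul_one]
      rw [pow_succ (-1 : k) m]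
      linear_combination ((-1) ^ m * qPascal v n (m + 1)) * e4 +
        ((-1) ^ m * qPascal v n m) * e2
    · simp [qPascal, pow_succ', mul_assoc]

lemma qSerre_eq_qIter (v b : k) (hv : v ≠ 0) (h : ∀ n : ℕ, 0 < n → v ^ n ≠ 1) (r : ℕ)
    (hb : b * v ^ r = v) (x y : R) : qSerre v r x y = qIter v b x y r := by
  have e : b = (b * v⁻¹) * v := by rw [mul_assoc, inv_mul_cancel₀ hv, mul_one]
  have e' : b * v⁻¹ * v ^ r = 1 := by
    rw [mul_right_comm, hb, mul_inv_cancel₀ hv]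
  rw [e, qIter_eq_sum _ _ hv, qSerre]
  refine Finset.sum_congr rfl fun m hm => ?_
  rw [qBinom_eq_qPascal v hv h (Nat.lt_succ_iff.1 (Finset.mem_range.1 hm)), e', one_pow, mul_one]

lemma qIter_comm (v b : k) (x y z : R) (hyx : y * x = v ^ 2 • (x * y))
    (hyz : y * z = b • (z * y)) (n : ℕ) :
    y * qIter v b x z n = (b * v ^ (2 * n)) • (qIter v b x z n * y) := by
  induction n with
  | zero => simpa [qIter] using hyz
  | succ n ih =>
    rw [qIter, mul_sub, sub_mul, ← mul_assoc, hyx, mul_smul_comm, ← mul_assoc y, ih]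
    simp only [smul_mul_assoc, mul_assoc, ih, hyx, mul_smul_comm, smul_smul, smul_sub]
    congr 1 <;> congr 1 <;> ring

lemma qIter_add (v b : k) (x y z : R) (hyx : y * x = v ^ 2 • (x * y))
    (hyz : y * z = b • (z * y)) (n : ℕ) :
    qIter v b (x + y) z n = qIter v b x z n := by
  induction n with
  | zero => rfl
  | succ n ih =>
    rw [qIter, qIter, ih, add_mul, mul_add, smul_add, qIter_comm v b x y z hyx hyz]
    abel

lemma qSerre_add_left (v b : k) (hv : v ≠ 0) (h : ∀ n : ℕ, 0 < n → v ^ n ≠ 1) (r : ℕ)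
    (hb : b * v ^ r = v) (x y z : R) (hyx : y * x = v ^ 2 • (x * y))
    (hyz : y * z = b • (z * y)) :
    qSerre v r (x + y) z = qSerre v r x z := by
  rw [qSerre_eq_qIter v b hv h r hb, qSerre_eq_qIter v b hv h r hb, qIter_add v b x y z hyx hyz]

lemma qSerre_add_right (v b : k) (hv : v ≠ 0) (h : ∀ n : ℕ, 0 < n → v ^ n ≠ 1) (r : ℕ)
    (hb : b * v ^ r = v) (x y w : R) (hyx : y * x = v ^ 2 • (x * y))
    (hxw : w * x = b • (x * w)) :
    qSerre v r (x + y) w = qSerre v r y w := by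
  have hb0 : b ≠ 0 := by
    rintro rfl
    rw [zero_mul] at hb
    exact hv hb.symm
  rw [← qSerre_inv v, ← qSerre_inv v, add_comm]
  refine qSerre_add_left v⁻¹ b⁻¹ (inv_ne_zero hv) ?_ r ?_ y x w ?_ ?_
  · intro n hn h1
    exact h n hn (by rwa [inv_pow, inv_eq_one] at h1)
  · rw [inv_pow, ← mul_inv, hb]
  · rw [hyx, smul_smul, inv_pow, inv_mul_cancel₀ (pow_ne_zero 2 hv), one_smul]
  · rw [hxw, smul_smul, inv_mul_cancel₀ hb0, one_smul]

lemma qSerre_add_third (v : k) (r : ℕ) (x y z : R) :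
    qSerre v r x (y + z) = qSerre v r x y + qSerre v r x z := by
  simp only [qSerre, mul_add, add_mul, smul_add, Finset.sum_add_distrib]

lemma map_qSerre {R' : Type*} [Ring R'] [Algebra k R'] (f : R →ₐ[k] R') (v : k) (r : ℕ) (x y : R) :
    f (qSerre v r x y) = qSerre v r (f x) (f y) := by
  simp [qSerre]

lemma qSerre_smul (v : k) (r : ℕ) (s t : k) (x y : R) :
    qSerre v r (s • x) (t • y) = (s ^ r * t) • qSerre v r x y := by
  rw [qSerre, qSerre, Finset.smul_sum]
  refine Finset.sum_congr rfl fun m hm => ?_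
  have hm' := Nat.lt_succ_iff.1 (Finset.mem_range.1 hm)
  have e : s ^ r = s ^ (r - m) * s ^ m := by rw [← pow_add, Nat.sub_add_cancel hm']
  rw [smul_pow, smul_pow, smul_mul_smul_comm, smul_mul_smul_comm, smul_smul, smul_smul, e]
  congr 1
  ring

/-- Reversing the order of the factors changes the quantum Serre expression by a sign. -/
lemma qSerre_op (v : k) (r : ℕ) (x y : R) :
    qSerre v r (MulOpposite.op x) (MulOpposite.op y) =
      (-1 : k) ^ r • MulOpposite.op (qSerre v r x y) := by
  rw [qSerre, qSerre, ← Finset.sum_range_reflect, Finset.op_sum, Finset.smul_sum]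
  refine Finset.sum_congr rfl fun m hm => ?_
  have hm' := Nat.lt_succ_iff.1 (Finset.mem_range.1 hm)
  have e : (-1 : k) ^ (r - m) = (-1) ^ r * (-1) ^ m := by
    rw [← Nat.sub_add_cancel hm', pow_add, Nat.sub_add_cancel hm', mul_assoc, ← mul_pow]
    simp
  rw [show r + 1 - 1 - m = r - m by omega, Nat.sub_sub_self hm', qBinom_symm v hm',
    MulOpposite.op_smul, smul_smul, e, ← MulOpposite.op_pow, ← MulOpposite.op_pow,
    ← MulOpposite.op_mul, ← MulOpposite.op_mul, mul_assoc, mul_assoc]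

lemma qSerre_tmul_left (v : k) (r : ℕ) (x y c d : R) (h : Commute c d) :
    qSerre v r (x ⊗ₜ[k] c) (y ⊗ₜ[k] d) = qSerre v r x y ⊗ₜ[k] (c ^ r * d) := by
  rw [qSerre, qSerre, TensorProduct.sum_tmul]
  refine Finset.sum_congr rfl fun m hm => ?_
  have hm' := Nat.lt_succ_iff.1 (Finset.mem_range.1 hm)
  rw [Algebra.TensorProduct.tmul_pow, Algebra.TensorProduct.tmul_pow,
    Algebra.TensorProduct.tmul_mul_tmul, Algebra.TensorProduct.tmul_mul_tmul, mul_assoc (c ^ _),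
    ← (h.pow_left m).eq, ← mul_assoc (c ^ _), ← pow_add, Nat.sub_add_cancel hm',
    TensorProduct.smul_tmul']

lemma qSerre_tmul_right (v : k) (r : ℕ) (x y c d : R) (h : Commute c d) :
    qSerre v r (c ⊗ₜ[k] x) (d ⊗ₜ[k] y) = (c ^ r * d) ⊗ₜ[k] qSerre v r x y := by
  rw [qSerre, qSerre, TensorProduct.tmul_sum]
  refine Finset.sum_congr rfl fun m hm => ?_
  have hm' := Nat.lt_succ_iff.1 (Finset.mem_range.1 hm)
  rw [Algebra.TensorProduct.tmul_pow, Algebra.TensorProduct.tmul_pow,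
    Algebra.TensorProduct.tmul_mul_tmul, Algebra.TensorProduct.tmul_mul_tmul, mul_assoc (c ^ _),
    ← (h.pow_left m).eq, ← mul_assoc (c ^ _), ← pow_add, Nat.sub_add_cancel hm',
    TensorProduct.tmul_smul]

/-- The quantum Serre relation is inherited by the elements `x ⊗ κ' + κ ⊗ x`, `z ⊗ μ' + μ ⊗ z`. -/
lemma qSerre_comul (v p : k) (hv : v ≠ 0) (h : ∀ n : ℕ, 0 < n → v ^ n ≠ 1) (r : ℕ)
    (hp : p ^ 2 * v ^ r = v) (x z κ κ' μ μ' : R) (hκx : κ * x = v • (x * κ))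
    (hxκ : x * κ' = v • (κ' * x)) (hκz : κ * z = p • (z * κ)) (hxμ : x * μ' = p • (μ' * x))
    (hzκ : z * κ' = p • (κ' * z)) (hμx : μ * x = p • (x * μ)) (hκμ : Commute κ μ)
    (hκμ' : Commute κ' μ') (hs : qSerre v r x z = 0) :
    qSerre v r (x ⊗ₜ[k] κ' + κ ⊗ₜ[k] x) (z ⊗ₜ[k] μ' + μ ⊗ₜ[k] z) = 0 := by
  have h1 : (κ ⊗ₜ[k] x) * (x ⊗ₜ[k] κ') = v ^ 2 • ((x ⊗ₜ[k] κ') * (κ ⊗ₜ[k] x)) := by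
    simp only [Algebra.TensorProduct.tmul_mul_tmul, hκx, hxκ, TensorProduct.smul_tmul_smul, pow_two]
  have h2 : (κ ⊗ₜ[k] x) * (z ⊗ₜ[k] μ') = p ^ 2 • ((z ⊗ₜ[k] μ') * (κ ⊗ₜ[k] x)) := by
    simp only [Algebra.TensorProduct.tmul_mul_tmul, hκz, hxμ, TensorProduct.smul_tmul_smul, pow_two]
  have h3 : (μ ⊗ₜ[k] z) * (x ⊗ₜ[k] κ') = p ^ 2 • ((x ⊗ₜ[k] κ') * (μ ⊗ₜ[k] z)) := by
    simp only [Algebra.TensorProduct.tmul_mul_tmul, hμx, hzκ, TensorProduct.smul_tmul_smul, pow_two]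
  rw [qSerre_add_third, qSerre_add_left v (p ^ 2) hv h r hp _ _ _ h1 h2,
    qSerre_add_right v (p ^ 2) hv h r hp _ _ _ h1 h3, qSerre_tmul_left _ _ _ _ _ _ hκμ',
    qSerre_tmul_right _ _ _ _ _ _ hκμ, hs, TensorProduct.zero_tmul, TensorProduct.tmul_zero,
    add_zero]

end QuantumCombinatorics

section QuantumGroup

/-- A symmetrizable generalized Cartan matrix `A` with a choice of positive integers `d i` such that
`d i * A i j` is symmetric. -/
structure CartanDatum (ι : Type u) where
  /-- The generalized Cartan matrix. -/
  A : Matrix ι ι ℤ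
  /-- The symmetrizing integers. -/
  d : ι → ℕ
  diag : ∀ i, A i i = 2
  offDiag : ∀ i j, i ≠ j → A i j ≤ 0
  d_pos : ∀ i, 0 < d i
  symm : ∀ i j, (d i : ℤ) * A i j = d j * A j i

variable {k : Type*} [Field k] {ι : Type u}

namespace CartanDatum

variable (c : CartanDatum ι) (q : kˣ)

/-- The scalar `q ^ (d i * a i j)`. -/
def scal (i j : ι) : k := ((q ^ ((c.d i : ℤ) * c.A i j) : kˣ) : k)

/-- The scalar `q ^ (2 * d i)`. -/
def base (i : ι) : k := (q : k) ^ (2 * c.d i)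

/-- The exponent `1 - a i j` in the quantum Serre relations, a natural number for `i ≠ j`. -/
def serreExp (i j : ι) : ℕ := (1 - c.A i j).toNat

end CartanDatum

/-- The generators `E i`, `F i`, `K i` and `K i⁻¹`. -/
inductive QGen (ι : Type u) : Type u
  | E (i : ι)
  | F (i : ι)
  | K (i : ι)
  | Kinv (i : ι)

/-- The defining relations of the quantum enveloping algebra. -/
inductive QRel (c : CartanDatum ι) (q : kˣ) :
    FreeAlgebra k (QGen ι) → FreeAlgebra k (QGen ι) → Prop
  | K_Kinv (i : ι) : QRel c q (FreeAlgebra.ι k (.K i) * FreeAlgebra.ι k (.Kinv i)) 1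
  | Kinv_K (i : ι) : QRel c q (FreeAlgebra.ι k (.Kinv i) * FreeAlgebra.ι k (.K i)) 1
  | K_K (i j : ι) : QRel c q (FreeAlgebra.ι k (.K i) * FreeAlgebra.ι k (.K j))
      (FreeAlgebra.ι k (.K j) * FreeAlgebra.ι k (.K i))
  | K_E (i j : ι) : QRel c q (FreeAlgebra.ι k (.K i) * FreeAlgebra.ι k (.E j))
      (c.scal q i j • (FreeAlgebra.ι k (.E j) * FreeAlgebra.ι k (.K i)))
  | K_F (i j : ι) : QRel c q (FreeAlgebra.ι k (.K i) * FreeAlgebra.ι k (.F j))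
      ((c.scal q i j)⁻¹ • (FreeAlgebra.ι k (.F j) * FreeAlgebra.ι k (.K i)))
  | E_F (i : ι) : QRel c q
      (FreeAlgebra.ι k (.E i) * FreeAlgebra.ι k (.F i) -
        FreeAlgebra.ι k (.F i) * FreeAlgebra.ι k (.E i))
      ((c.base q i - (c.base q i)⁻¹)⁻¹ •
        (FreeAlgebra.ι k (.K i) ^ 2 - FreeAlgebra.ι k (.Kinv i) ^ 2))
  | E_F_ne (i j : ι) (h : i ≠ j) : QRel c q
      (FreeAlgebra.ι k (.E i) * FreeAlgebra.ι k (.F j) -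
        FreeAlgebra.ι k (.F j) * FreeAlgebra.ι k (.E i)) 0
  | serreE (i j : ι) (h : i ≠ j) : QRel c q
      (qSerre (c.base q i) (c.serreExp i j) (FreeAlgebra.ι k (.E i)) (FreeAlgebra.ι k (.E j))) 0
  | serreF (i j : ι) (h : i ≠ j) : QRel c q
      (qSerre (c.base q i) (c.serreExp i j) (FreeAlgebra.ι k (.F i)) (FreeAlgebra.ι k (.F j))) 0

/-- The quantum enveloping algebra `U_q` of a symmetrizable generalized Cartan matrix, for `q ≠ 0`
not a root of unity: the algebra with generators `E i`, `F i`, `K i`, `K i⁻¹` and the relations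
`K i K j = K j K i`, `K i E j = q ^ (d i * a i j) E j K i`, `K i F j = q ^ (- d i * a i j) F j K i`,
`E i F j - F j E i = δ i j (K i ^ 2 - K i ^ (-2)) / (q ^ (2 d i) - q ^ (- 2 d i))` and the quantum
Serre relations. -/
def QuantumEnveloping (c : CartanDatum ι) (q : kˣ) (_hq : ¬ IsOfFinOrder q) :=
  RingQuot (QRel c q)

/-- Families of elements in an algebra that satisfy the relations of `U_q`. -/
structure QRelations (c : CartanDatum ι) (q : kˣ) {D : Type*} [Ring D] [Algebra k D]
    (e f κ κ' : ι → D) : Prop where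
  K_Kinv : ∀ i, κ i * κ' i = 1
  Kinv_K : ∀ i, κ' i * κ i = 1
  K_K : ∀ i j, κ i * κ j = κ j * κ i
  K_E : ∀ i j, κ i * e j = c.scal q i j • (e j * κ i)
  K_F : ∀ i j, κ i * f j = (c.scal q i j)⁻¹ • (f j * κ i)
  E_F : ∀ i, e i * f i - f i * e i =
    (c.base q i - (c.base q i)⁻¹)⁻¹ • (κ i ^ 2 - κ' i ^ 2)
  E_F_ne : ∀ i j, i ≠ j → e i * f j - f j * e i = 0
  serreE : ∀ i j, i ≠ j → qSerre (c.base q i) (c.serreExp i j) (e i) (e j) = 0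
  serreF : ∀ i j, i ≠ j → qSerre (c.base q i) (c.serreExp i j) (f i) (f j) = 0

namespace QRelations

variable {c : CartanDatum ι} {q : kˣ} {D : Type*} [Ring D] [Algebra k D] {e f κ κ' : ι → D}

lemma swap_inv {x a a' : D} {s : k} (h1 : a * a' = 1) (h2 : a' * a = 1)
    (h : a * x = s • (x * a)) : x * a' = s • (a' * x) := by
  calc x * a' = a' * (a * x) * a' := by rw [← mul_assoc a', h2, one_mul]
    _ = s • (a' * x * (a * a')) := by
      rw [h, mul_smul_comm, smul_mul_assoc, ← mul_assoc a', mul_assoc (a' * x)]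
    _ = s • (a' * x) := by rw [h1, mul_one]

lemma E_Kinv (H : QRelations c q e f κ κ') (i j : ι) : e j * κ' i = c.scal q i j • (κ' i * e j) :=
  swap_inv (H.K_Kinv i) (H.Kinv_K i) (H.K_E i j)

lemma F_Kinv (H : QRelations c q e f κ κ') (i j : ι) : f j * κ' i = (c.scal q i j)⁻¹ • (κ' i * f j) :=
  swap_inv (H.K_Kinv i) (H.Kinv_K i) (H.K_F i j)

lemma Kinv_Kinv (H : QRelations c q e f κ κ') (i j : ι) : κ' i * κ' j = κ' j * κ' i := by
  have h1 : κ j * κ' i = κ' i * κ j := by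
    simpa using swap_inv (s := (1 : k)) (H.K_Kinv i) (H.Kinv_K i) (by rw [one_smul]; exact H.K_K i j)
  simpa using swap_inv (s := (1 : k)) (H.K_Kinv j) (H.Kinv_K j) (by rw [one_smul]; exact h1)

end QRelations

lemma CartanDatum.scal_ne_zero (c : CartanDatum ι) (q : kˣ) (i j : ι) : c.scal q i j ≠ 0 :=
  Units.ne_zero _

lemma CartanDatum.base_ne_zero (c : CartanDatum ι) (q : kˣ) (i : ι) : c.base q i ≠ 0 :=
  pow_ne_zero _ q.ne_zero

lemma CartanDatum.scal_symm (c : CartanDatum ι) (q : kˣ) (i j : ι) :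
    c.scal q j i = c.scal q i j := by
  rw [scal, scal, c.symm]

lemma CartanDatum.scal_self (c : CartanDatum ι) (q : kˣ) (i : ι) :
    c.scal q i i = c.base q i := by
  rw [scal, base, c.diag, mul_comm]
  have : (2 : ℤ) * (c.d i : ℤ) = ((2 * c.d i : ℕ) : ℤ) := by push_cast; rfl
  rw [this, zpow_natCast, Units.val_pow_eq_pow_val]

lemma CartanDatum.base_pow_ne_one (c : CartanDatum ι) (q : kˣ) (hq : ¬ IsOfFinOrder q) (i : ι)
    (n : ℕ) (hn : 0 < n) : c.base q i ^ n ≠ 1 := by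
  intro h
  apply hq
  rw [isOfFinOrder_iff_pow_eq_one]
  refine ⟨2 * c.d i * n, Nat.mul_pos (Nat.mul_pos two_pos (c.d_pos i)) hn, ?_⟩
  rw [base, ← pow_mul] at h
  exact Units.ext (by push_cast; exact h)

lemma CartanDatum.scal_sq_mul (c : CartanDatum ι) (q : kˣ) {i j : ι} (hij : i ≠ j) :
    c.scal q i j ^ 2 * c.base q i ^ c.serreExp i j = c.base q i := by
  have h1 : ((c.serreExp i j : ℕ) : ℤ) = 1 - c.A i j := by
    rw [serreExp, Int.toNat_of_nonneg]
    have := c.offDiag i j hij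
    omega
  have h2 : (q ^ ((c.d i : ℤ) * c.A i j)) ^ 2 * (q ^ (2 * c.d i)) ^ c.serreExp i j =
      q ^ (2 * c.d i) := by
    rw [← zpow_natCast, ← zpow_natCast, ← zpow_natCast, ← zpow_mul, ← zpow_mul, ← zpow_add, h1]
    congr 1
    push_cast
    ring
  have h3 := congrArg (fun u : kˣ => (u : k)) h2
  simpa [scal, base] using h3

namespace QuantumEnveloping

variable (c : CartanDatum ι) (q : kˣ) (hq : ¬ IsOfFinOrder q)

noncomputable instance : Ring (QuantumEnveloping c q hq) := inferInstanceAs (Ring (RingQuot _))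

noncomputable instance : Algebra k (QuantumEnveloping c q hq) :=
  inferInstanceAs (Algebra k (RingQuot _))

/-- The quotient map from the free algebra. -/
noncomputable def mk : FreeAlgebra k (QGen ι) →ₐ[k] QuantumEnveloping c q hq :=
  RingQuot.mkAlgHom k (QRel c q)

/-- The generator `E i`. -/
noncomputable def E (i : ι) : QuantumEnveloping c q hq := mk c q hq (FreeAlgebra.ι k (.E i))

/-- The generator `F i`. -/
noncomputable def F (i : ι) : QuantumEnveloping c q hq := mk c q hq (FreeAlgebra.ι k (.F i))

/-- The generator `K i`. -/
noncomputable def K (i : ι) : QuantumEnveloping c q hq := mk c q hq (FreeAlgebra.ι k (.K i))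

/-- The generator `K i⁻¹`. -/
noncomputable def Kinv (i : ι) : QuantumEnveloping c q hq := mk c q hq (FreeAlgebra.ι k (.Kinv i))

lemma relations : QRelations c q (E c q hq) (F c q hq) (K c q hq) (Kinv c q hq) := by
  have key : ∀ {a b}, QRel c q a b → mk c q hq a = mk c q hq b :=
    fun h => RingQuot.mkAlgHom_rel k h
  constructor
  · intro i; simpa using! key (.K_Kinv i)
  · intro i; simpa using! key (.Kinv_K i)
  · intro i j; simpa using! key (.K_K i j)
  · intro i j; simpa using! key (.K_E i j)
  · intro i j; simpa using! key (.K_F i j)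
  · intro i; simpa using! key (.E_F i)
  · intro i j h; simpa using! key (.E_F_ne i j h)
  · intro i j h; simpa only [map_qSerre, map_zero] using! key (.serreE i j h)
  · intro i j h; simpa only [map_qSerre, map_zero] using! key (.serreF i j h)

variable {c q}
variable {D : Type*} [Ring D] [Algebra k D]

/-- The map from the generators to an algebra. -/
def genMap (e f κ κ' : ι → D) : QGen ι → D
  | .E i => e i
  | .F i => f i
  | .K i => κ i
  | .Kinv i => κ' i

/-- The universal property of `U_q`. -/
noncomputable def lift {e f κ κ' : ι → D} (H : QRelations c q e f κ κ') :
    QuantumEnveloping c q hq →ₐ[k] D :=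
  RingQuot.liftAlgHom k ⟨FreeAlgebra.lift k (genMap e f κ κ'), by
    intro x y h
    cases h with
    | K_Kinv i => simpa [genMap] using H.K_Kinv i
    | Kinv_K i => simpa [genMap] using H.Kinv_K i
    | K_K i j => simpa [genMap] using H.K_K i j
    | K_E i j => simpa [genMap] using H.K_E i j
    | K_F i j => simpa [genMap] using H.K_F i j
    | E_F i => simpa [genMap] using H.E_F i
    | E_F_ne i j h => simpa [genMap] using H.E_F_ne i j h
    | serreE i j h => simpa [genMap, map_qSerre] using H.serreE i j h
    | serreF i j h => simpa [genMap, map_qSerre] using H.serreF i j h⟩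

lemma lift_mk {e f κ κ' : ι → D} (H : QRelations c q e f κ κ') (x : QGen ι) :
    lift hq H (mk c q hq (FreeAlgebra.ι k x)) = genMap e f κ κ' x := by
  unfold lift mk
  erw [RingQuot.liftAlgHom_mkAlgHom_apply]
  simp

@[simp] lemma lift_E {e f κ κ' : ι → D} (H : QRelations c q e f κ κ') (i : ι) :
    lift hq H (E c q hq i) = e i := lift_mk hq H (.E i)

@[simp] lemma lift_F {e f κ κ' : ι → D} (H : QRelations c q e f κ κ') (i : ι) :
    lift hq H (F c q hq i) = f i := lift_mk hq H (.F i)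

@[simp] lemma lift_K {e f κ κ' : ι → D} (H : QRelations c q e f κ κ') (i : ι) :
    lift hq H (K c q hq i) = κ i := lift_mk hq H (.K i)

@[simp] lemma lift_Kinv {e f κ κ' : ι → D} (H : QRelations c q e f κ κ') (i : ι) :
    lift hq H (Kinv c q hq i) = κ' i := lift_mk hq H (.Kinv i)

variable {hq} in
lemma algHom_ext {f g : QuantumEnveloping c q hq →ₐ[k] D} (hE : ∀ i, f (E c q hq i) = g (E c q hq i))
    (hF : ∀ i, f (F c q hq i) = g (F c q hq i)) (hK : ∀ i, f (K c q hq i) = g (K c q hq i))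
    (hK' : ∀ i, f (Kinv c q hq i) = g (Kinv c q hq i)) : f = g := by
  apply RingQuot.ringQuot_ext'
  apply FreeAlgebra.hom_ext
  funext x
  cases x with
  | E i => exact hE i
  | F i => exact hF i
  | K i => exact hK i
  | Kinv i => exact hK' i

variable (c q)

/-- The set of generators. -/
def gens : Set (QuantumEnveloping c q hq) :=
  Set.range (fun x => mk c q hq (FreeAlgebra.ι k x))

lemma adjoin_gens : Algebra.adjoin k (gens c q hq) = ⊤ := by
  have h1 : (mk c q hq).range = ⊤ :=
    (AlgHom.range_eq_top _).2 (RingQuot.mkAlgHom_surjective k (QRel c q))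
  rw [← h1, ← Algebra.map_top, ← FreeAlgebra.adjoin_range_ι, AlgHom.map_adjoin, ← Set.range_comp]
  rfl

lemma comul_relations : QRelations c q
    (fun i => E c q hq i ⊗ₜ[k] Kinv c q hq i + K c q hq i ⊗ₜ[k] E c q hq i)
    (fun i => F c q hq i ⊗ₜ[k] Kinv c q hq i + K c q hq i ⊗ₜ[k] F c q hq i)
    (fun i => K c q hq i ⊗ₜ[k] K c q hq i)
    (fun i => Kinv c q hq i ⊗ₜ[k] Kinv c q hq i) := by
  have H := relations c q hq
  have hEF : ∀ i j, (E c q hq i ⊗ₜ[k] Kinv c q hq i + K c q hq i ⊗ₜ[k] E c q hq i) *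
      (F c q hq j ⊗ₜ[k] Kinv c q hq j + K c q hq j ⊗ₜ[k] F c q hq j) -
      (F c q hq j ⊗ₜ[k] Kinv c q hq j + K c q hq j ⊗ₜ[k] F c q hq j) *
      (E c q hq i ⊗ₜ[k] Kinv c q hq i + K c q hq i ⊗ₜ[k] E c q hq i) =
      (E c q hq i * F c q hq j - F c q hq j * E c q hq i) ⊗ₜ[k]
        (Kinv c q hq i * Kinv c q hq j) +
      (K c q hq i * K c q hq j) ⊗ₜ[k]
        (E c q hq i * F c q hq j - F c q hq j * E c q hq i) := by
    intro i j
    have h1 : (K c q hq i * F c q hq j) ⊗ₜ[k] (E c q hq i * Kinv c q hq j) =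
        (F c q hq j * K c q hq i) ⊗ₜ[k] (Kinv c q hq j * E c q hq i) := by
      rw [H.K_F, H.E_Kinv, TensorProduct.smul_tmul_smul, c.scal_symm,
        inv_mul_cancel₀ (c.scal_ne_zero q j i), one_smul]
    have h2 : (K c q hq j * E c q hq i) ⊗ₜ[k] (F c q hq j * Kinv c q hq i) =
        (E c q hq i * K c q hq j) ⊗ₜ[k] (Kinv c q hq i * F c q hq j) := by
      rw [H.K_E, H.F_Kinv, TensorProduct.smul_tmul_smul, c.scal_symm,
        mul_inv_cancel₀ (c.scal_ne_zero q i j), one_smul]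
    simp only [add_mul, mul_add, Algebra.TensorProduct.tmul_mul_tmul, h1, h2,
      TensorProduct.sub_tmul, TensorProduct.tmul_sub, H.Kinv_Kinv j i, H.K_K j i]
    abel
  have hb := c.base_ne_zero q
  have hb1 := c.base_pow_ne_one q hq
  constructor
  · intro i
    rw [Algebra.TensorProduct.tmul_mul_tmul, H.K_Kinv, Algebra.TensorProduct.one_def]
  · intro i
    rw [Algebra.TensorProduct.tmul_mul_tmul, H.Kinv_K, Algebra.TensorProduct.one_def]
  · intro i j
    rw [Algebra.TensorProduct.tmul_mul_tmul, Algebra.TensorProduct.tmul_mul_tmul, H.K_K]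
  · intro i j
    simp only [mul_add, add_mul, Algebra.TensorProduct.tmul_mul_tmul, H.K_E, H.K_K i j, smul_add]
    have h : K c q hq i * Kinv c q hq j = Kinv c q hq j * K c q hq i := by
      simpa using QRelations.swap_inv (s := (1 : k)) (H.K_Kinv j) (H.Kinv_K j)
        (by rw [one_smul]; exact H.K_K j i)
    rw [h, TensorProduct.smul_tmul', TensorProduct.tmul_smul]
  · intro i j
    simp only [mul_add, add_mul, Algebra.TensorProduct.tmul_mul_tmul, H.K_F, H.K_K i j, smul_add]
    have h : K c q hq i * Kinv c q hq j = Kinv c q hq j * K c q hq i := by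
      simpa using QRelations.swap_inv (s := (1 : k)) (H.K_Kinv j) (H.Kinv_K j)
        (by rw [one_smul]; exact H.K_K j i)
    rw [h, TensorProduct.smul_tmul', TensorProduct.tmul_smul]
  · intro i
    rw [hEF, H.E_F, Algebra.TensorProduct.tmul_pow, Algebra.TensorProduct.tmul_pow, ← pow_two,
      ← pow_two, TensorProduct.tmul_smul, ← TensorProduct.smul_tmul', ← smul_add,
      TensorProduct.sub_tmul, TensorProduct.tmul_sub]
    congr 1
    abel
  · intro i j h
    rw [hEF, H.E_F_ne i j h, TensorProduct.zero_tmul, TensorProduct.tmul_zero, add_zero]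
  · intro i j h
    refine qSerre_comul (c.base q i) (c.scal q i j) (hb i) (hb1 i) _ (c.scal_sq_mul q h) _ _ _ _ _ _
      ?_ ?_ (H.K_E i j) ?_ (H.E_Kinv i j) ?_ (H.K_K i j) (H.Kinv_Kinv i j) (H.serreE i j h)
    · rw [H.K_E, c.scal_self]
    · rw [H.E_Kinv, c.scal_self]
    · rw [H.E_Kinv, c.scal_symm]
    · rw [H.K_E, c.scal_symm]
  · intro i j h
    rw [← qSerre_inv]
    refine qSerre_comul (c.base q i)⁻¹ (c.scal q i j)⁻¹ (inv_ne_zero (hb i)) ?_ _ ?_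
      _ _ _ _ _ _ ?_ ?_ (H.K_F i j) ?_ (H.F_Kinv i j) ?_ (H.K_K i j) (H.Kinv_Kinv i j) ?_
    · intro n hn h1
      exact hb1 i n hn (by rwa [inv_pow, inv_eq_one] at h1)
    · rw [inv_pow, inv_pow, ← mul_inv, c.scal_sq_mul q h]
    · rw [H.K_F, c.scal_self]
    · rw [H.F_Kinv, c.scal_self]
    · rw [H.F_Kinv, c.scal_symm]
    · rw [H.K_F, c.scal_symm]
    · rw [qSerre_inv]
      exact H.serreF i j h

lemma qSerre_zero_zero (v : k) (r : ℕ) : qSerre v r (0 : D) 0 = 0 := by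
  simp [qSerre]

lemma counit_relations : QRelations (D := k) c q (fun _ => 0) (fun _ => 0) (fun _ => 1)
    (fun _ => 1) := by
  constructor <;> intros <;> simp [qSerre_zero_zero]

open MulOpposite in
lemma antipode_relations : QRelations c q
    (fun i => (-(c.base q i)⁻¹) • op (E c q hq i)) (fun i => (-(c.base q i)) • op (F c q hq i))
    (fun i => op (Kinv c q hq i)) (fun i => op (K c q hq i)) := by
  have H := relations c q hq
  have hb := c.base_ne_zero q
  constructor
  · intro i; rw [← op_mul, H.K_Kinv, op_one]
  · intro i; rw [← op_mul, H.Kinv_K, op_one]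
  · intro i j; rw [← op_mul, H.Kinv_Kinv, op_mul]
  · intro i j
    rw [mul_smul_comm, ← op_mul, H.E_Kinv, smul_mul_assoc, ← op_mul, op_smul, smul_comm]
  · intro i j
    rw [mul_smul_comm, ← op_mul, H.F_Kinv, smul_mul_assoc, ← op_mul, op_smul, smul_comm]
  · intro i
    rw [smul_mul_smul_comm, smul_mul_smul_comm, neg_mul_neg, neg_mul_neg, inv_mul_cancel₀ (hb i),
      mul_inv_cancel₀ (hb i), one_smul, one_smul, ← op_mul, ← op_mul, ← op_sub, ← neg_sub, H.E_F,
      ← smul_neg, neg_sub, op_smul, op_sub, op_pow, op_pow]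
  · intro i j h
    rw [smul_mul_smul_comm, smul_mul_smul_comm, mul_comm (-c.base q j), ← smul_sub, ← op_mul,
      ← op_mul, ← op_sub, ← neg_sub, H.E_F_ne i j h]
    simp
  · intro i j h
    rw [qSerre_smul, qSerre_op, H.serreE i j h]
    simp
  · intro i j h
    rw [qSerre_smul, qSerre_op, H.serreF i j h]
    simp

/-- The comultiplication `Δ(X) = X ⊗ K i⁻¹ + K i ⊗ X` for `X = E i, F i`, `Δ(K i) = K i ⊗ K i`. -/
noncomputable def comulHom :
    QuantumEnveloping c q hq →ₐ[k] QuantumEnveloping c q hq ⊗[k] QuantumEnveloping c q hq :=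
  lift hq (comul_relations c q hq)

/-- The counit `ε(E i) = ε(F i) = 0`, `ε(K i) = 1`. -/
noncomputable def counitHom : QuantumEnveloping c q hq →ₐ[k] k :=
  lift hq (counit_relations c q)

/-- The antipode `S(E i) = - q ^ (- 2 d i) E i`, `S(F i) = - q ^ (2 d i) F i`, `S(K i) = K i⁻¹`, as
an algebra anti-homomorphism. -/
noncomputable def antipodeHom : QuantumEnveloping c q hq →ₐ[k] (QuantumEnveloping c q hq)ᵐᵒᵖ :=
  lift hq (antipode_relations c q hq)

noncomputable instance : Bialgebra k (QuantumEnveloping c q hq) :=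
  Bialgebra.ofAlgHom (comulHom c q hq) (counitHom c q hq)
    (by
      apply algHom_ext <;> intro i <;>
        simp [comulHom, TensorProduct.tmul_add, TensorProduct.add_tmul, add_assoc])
    (by apply algHom_ext <;> intro i <;> simp [comulHom, counitHom])
    (by apply algHom_ext <;> intro i <;> simp [comulHom, counitHom])

lemma comul_E (i : ι) : Coalgebra.comul (R := k) (E c q hq i) =
    E c q hq i ⊗ₜ Kinv c q hq i + K c q hq i ⊗ₜ E c q hq i :=
  lift_E hq (comul_relations c q hq) i

lemma comul_F (i : ι) : Coalgebra.comul (R := k) (F c q hq i) =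
    F c q hq i ⊗ₜ Kinv c q hq i + K c q hq i ⊗ₜ F c q hq i :=
  lift_F hq (comul_relations c q hq) i

lemma comul_K (i : ι) : Coalgebra.comul (R := k) (K c q hq i) = K c q hq i ⊗ₜ K c q hq i :=
  lift_K hq (comul_relations c q hq) i

lemma comul_Kinv (i : ι) :
    Coalgebra.comul (R := k) (Kinv c q hq i) = Kinv c q hq i ⊗ₜ Kinv c q hq i :=
  lift_Kinv hq (comul_relations c q hq) i

lemma counit_E (i : ι) : Coalgebra.counit (R := k) (E c q hq i) = 0 :=
  lift_E hq (counit_relations c q) i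

lemma counit_F (i : ι) : Coalgebra.counit (R := k) (F c q hq i) = 0 :=
  lift_F hq (counit_relations c q) i

lemma counit_K (i : ι) : Coalgebra.counit (R := k) (K c q hq i) = 1 :=
  lift_K hq (counit_relations c q) i

lemma counit_Kinv (i : ι) : Coalgebra.counit (R := k) (Kinv c q hq i) = 1 :=
  lift_Kinv hq (counit_relations c q) i

lemma antipodeHom_E (i : ι) : antipodeHom c q hq (E c q hq i) =
    MulOpposite.op ((-(c.base q i)⁻¹) • E c q hq i) :=
  lift_E hq (antipode_relations c q hq) i

lemma antipodeHom_F (i : ι) : antipodeHom c q hq (F c q hq i) =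
    MulOpposite.op ((-(c.base q i)) • F c q hq i) :=
  lift_F hq (antipode_relations c q hq) i

lemma antipodeHom_K (i : ι) : antipodeHom c q hq (K c q hq i) =
    MulOpposite.op (Kinv c q hq i) :=
  lift_K hq (antipode_relations c q hq) i

lemma antipodeHom_Kinv (i : ι) : antipodeHom c q hq (Kinv c q hq i) =
    MulOpposite.op (K c q hq i) :=
  lift_Kinv hq (antipode_relations c q hq) i

noncomputable instance : HopfAlgebra k (QuantumEnveloping c q hq) :=
  hopfOfGenerators (antipodeHom c q hq) _ (adjoin_gens c q hq)
    (by
      have H := relations c q hq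
      have hb := c.base_ne_zero q
      rintro _ ⟨x | x | x | x, rfl⟩
      · change convLeft _ (Coalgebra.comul (E c q hq x)) = algebraMap k _
          (Coalgebra.counit (E c q hq x))
        rw [comul_E, counit_E, map_add, convLeft_tmul, convLeft_tmul, antipodeHom_E, antipodeHom_K,
          MulOpposite.unop_op, MulOpposite.unop_op, smul_mul_assoc, H.E_Kinv, c.scal_self, smul_smul,
          neg_mul, inv_mul_cancel₀ (hb x), map_zero, neg_smul, one_smul, neg_add_cancel]
      · change convLeft _ (Coalgebra.comul (F c q hq x)) = algebraMap k _
          (Coalgebra.counit (F c q hq x))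
        rw [comul_F, counit_F, map_add, convLeft_tmul, convLeft_tmul, antipodeHom_F, antipodeHom_K,
          MulOpposite.unop_op, MulOpposite.unop_op, smul_mul_assoc, H.F_Kinv, c.scal_self, smul_smul,
          neg_mul, mul_inv_cancel₀ (hb x), map_zero, neg_smul, one_smul, neg_add_cancel]
      · change convLeft _ (Coalgebra.comul (K c q hq x)) = algebraMap k _
          (Coalgebra.counit (K c q hq x))
        rw [comul_K, counit_K, convLeft_tmul, antipodeHom_K, MulOpposite.unop_op, H.Kinv_K, map_one]
      · change convLeft _ (Coalgebra.comul (Kinv c q hq x)) = algebraMap k _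
          (Coalgebra.counit (Kinv c q hq x))
        rw [comul_Kinv, counit_Kinv, convLeft_tmul, antipodeHom_Kinv, MulOpposite.unop_op, H.K_Kinv,
          map_one])
    (by
      have H := relations c q hq
      have hb := c.base_ne_zero q
      rintro _ ⟨x | x | x | x, rfl⟩
      · change convRight _ (Coalgebra.comul (E c q hq x)) = algebraMap k _
          (Coalgebra.counit (E c q hq x))
        rw [comul_E, counit_E, map_add, convRight_tmul, convRight_tmul, antipodeHom_E,
          antipodeHom_Kinv, MulOpposite.unop_op, MulOpposite.unop_op, mul_smul_comm, H.K_E,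
          c.scal_self, smul_smul, neg_mul, inv_mul_cancel₀ (hb x), map_zero, neg_smul, one_smul,
          add_neg_cancel]
      · change convRight _ (Coalgebra.comul (F c q hq x)) = algebraMap k _
          (Coalgebra.counit (F c q hq x))
        rw [comul_F, counit_F, map_add, convRight_tmul, convRight_tmul, antipodeHom_F,
          antipodeHom_Kinv, MulOpposite.unop_op, MulOpposite.unop_op, mul_smul_comm, H.K_F,
          c.scal_self, smul_smul, neg_mul, mul_inv_cancel₀ (hb x), map_zero, neg_smul, one_smul,
          add_neg_cancel]
      · change convRight _ (Coalgebra.comul (K c q hq x)) = algebraMap k _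
          (Coalgebra.counit (K c q hq x))
        rw [comul_K, counit_K, convRight_tmul, antipodeHom_K, MulOpposite.unop_op, H.K_Kinv, map_one]
      · change convRight _ (Coalgebra.comul (Kinv c q hq x)) = algebraMap k _
          (Coalgebra.counit (Kinv c q hq x))
        rw [comul_Kinv, counit_Kinv, convRight_tmul, antipodeHom_Kinv, MulOpposite.unop_op, H.Kinv_K,
          map_one])

end QuantumEnveloping

end QuantumGroup

end QuiverHopf

/-! The theorem is an instance of a general principle. Let a Hopf algebra `A` be generated as an
algebra by the images `φ g` of a commutative group `G`, all group-like, and by elements `y j` with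
`Δ(y j) = φ (w j) ⊗ y j + y j ⊗ 1`, and suppose that `y j * φ g = χ j g • (φ g * y j)` for
characters `χ j` of `G`. Take the quiver on `G` with one arrow from `g` to `g * w j` for every `g`
and `j`. Conjugacy classes in `G` are single elements, so this is a Hopf quiver. Let `G` act on the
arrows from the left by translation and from the right by translation with the factor `χ j`. Sending
the arrow from `g` to `g * w j` to `φ g * y j` is then a bimodule map, so it extends to an algebra
map on the semi-path algebra. Moreover `Δ(φ g * y j) = φ (g * w j) ⊗ φ g * y j + φ g * y j ⊗ φ g`,
which is the pattern `t(a) ⊗ a + a ⊗ s(a)` of the comultiplication of an arrow. The result is a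
surjective bialgebra map; its kernel is a Hopf ideal, and the first isomorphism theorem applies
(`TranslationGroup.exists_equiv_semiPath_quotient`, `isHopfIdeal_hopfKer`,
`nonempty_equiv_quotient_hopfKer`).

In `U_q` the generators `E i` and `F i` do not have this shape, since `Δ(X) = X ⊗ K i⁻¹ + K i ⊗ X`.
Multiplying by `K i` on the right repairs this: `X * K i` is skew-primitive of weight `K i ^ 2`
(`comul_skewPrim`), it commutes with the `K`'s up to powers of `q` (`skewPrim_mul_torusHom`), and
`X` is recovered from it by multiplying by `K i⁻¹` (`adjoin_torusHom_skewPrim`).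

The group is the free abelian group on the simple roots, mapped to the units of `U_q`. Whether this
map is injective plays no role, so no basis of `U_q` is needed. The relations between `E` and `F`
and the Serre relations need not be matched with explicit elements of the ideal either: the kernel
absorbs them. -/

namespace QuiverHopf

/-! ### Kernels of Hopf algebra maps and the first isomorphism theorem. -/

section HopfKernel

open WithConv LinearMap Coalgebra HopfAlgebra

variable {k A B : Type*} [CommRing k] [Ring A] [Ring B] [HopfAlgebra k A] [HopfAlgebra k B]

/-- A bialgebra homomorphism between Hopf algebras commutes with the antipodes. -/
lemma map_antipode (f : A →ₐc[k] B) (a : A) : f (antipode k a) = antipode k (f a) := by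
  -- In the convolution algebra of linear maps `A → B`, the map `antipode ∘ f` is a left inverse of
  -- `f` and `f ∘ antipode` is a right inverse, so the two coincide. The first identity uses that
  -- `f` is a coalgebra map, the second that it is an algebra map.
  have h1 : toConv (antipode k ∘ₗ f.toLinearMap) * toConv f.toLinearMap = 1 := by
    apply ofConv_injective
    calc (toConv (antipode k ∘ₗ f.toLinearMap) * toConv f.toLinearMap).ofConv
        = (toConv (antipode k) * toConv .id : WithConv (B →ₗ[k] B)).ofConv ∘ₗ
          f.toCoalgHom.toLinearMap := by rw [convMul_comp_coalgHom_distrib]; rfl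
      _ = (1 : WithConv (A →ₗ[k] B)).ofConv := by
        rw [antipode_mul_id, ← convOne_comp_coalgHom f.toCoalgHom]
  have h2 : toConv f.toLinearMap * toConv (f.toLinearMap ∘ₗ antipode k) = 1 := by
    apply ofConv_injective
    calc (toConv f.toLinearMap * toConv (f.toLinearMap ∘ₗ antipode k)).ofConv
        = (AlgHomClass.toAlgHom f).toLinearMap ∘ₗ
          (toConv .id * toConv (antipode k) : WithConv (A →ₗ[k] A)).ofConv := by
          rw [algHom_comp_convMul_distrib]; rfl
      _ = (1 : WithConv (A →ₗ[k] B)).ofConv := by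
        rw [id_mul_antipode, algHom_comp_convOne]
  exact (congrArg (fun g => g.ofConv a) (left_inv_eq_right_inv h1 h2)).symm

variable (f : A →ₐc[k] B)

/-- The kernel of a bialgebra homomorphism, as an ideal. -/
abbrev hopfKer : Ideal A := RingHom.ker (AlgHomClass.toAlgHom f : A →ₐ[k] B)

variable {f} in
lemma mem_hopfKer {x : A} : x ∈ hopfKer f ↔ f x = 0 := Iff.rfl

/-- The kernel of a surjective bialgebra homomorphism between Hopf algebras is a Hopf ideal. -/
lemma isHopfIdeal_hopfKer (hf : Function.Surjective f) : (hopfKer f).IsHopfIdeal k where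
  counit_eq_zero x hx := by
    rw [← CoalgHomClass.counit_comp_apply f x, mem_hopfKer.1 hx, map_zero]
  map_mkQ_comul_eq_zero x hx := by
    -- Since `f` is onto, the induced map on the quotient has an inverse, and the projection to the
    -- quotient is that inverse after `f`. Applying the projection to both factors of `Δ x` thus
    -- factors through `(f ⊗ f)(Δ x) = Δ(f x) = 0`.
    let e := Ideal.quotientKerAlgEquivOfSurjective (f := AlgHomClass.toAlgHom f) hf
    let e' : B →ₗ[k] (A ⧸ (hopfKer f).restrictScalars k) := e.symm.toLinearMap
    have he : ((hopfKer f).restrictScalars k).mkQ = e' ∘ₗ (f : A →ₗ[k] B) := by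
      ext a
      exact (Ideal.quotientKerAlgEquivOfSurjective_symm_apply
        (f := AlgHomClass.toAlgHom f) hf a).symm
    have h := CoalgHomClass.map_comp_comul_apply f x
    rw [mem_hopfKer.1 hx, map_zero] at h
    rw [he, TensorProduct.map_comp, LinearMap.comp_apply]
    exact (congrArg _ h).trans (map_zero _)
  antipode_mem x hx := by
    rw [mem_hopfKer] at hx ⊢
    rw [map_antipode, hx, map_zero]

/-- The first isomorphism theorem for Hopf algebras. -/
lemma nonempty_equiv_quotient_hopfKer (hf : Function.Surjective f)
    [(hopfKer f).IsHopfIdeal k] : Nonempty (B ≃ₐc[k] (A ⧸ hopfKer f)) := by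
  let e : (A ⧸ hopfKer f) ≃ₐ[k] B :=
    Ideal.quotientKerAlgEquivOfSurjective (f := AlgHomClass.toAlgHom f) hf
  -- Both compatibilities are equalities of algebra maps on the quotient. On representatives they
  -- become the corresponding properties of `f`.
  refine ⟨(BialgEquiv.ofAlgEquiv e ?_ ?_).symm⟩
  · refine Ideal.Quotient.algHom_ext k (AlgHom.ext fun a => ?_)
    exact CoalgHomClass.counit_comp_apply f a
  · refine Ideal.Quotient.algHom_ext k (AlgHom.ext fun a => ?_)
    change Algebra.TensorProduct.map e.toAlgHom e.toAlgHom
      (Coalgebra.comul (R := k) (Ideal.Quotient.mk (hopfKer f) a)) = Coalgebra.comul (f a)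
    rw [Bialgebra.Quotient.comul_mk, ← CoalgHomClass.map_comp_comul_apply f a]
    change (TensorProduct.map e.toLinearMap e.toLinearMap ∘ₗ _) _ = _
    rw [← TensorProduct.map_comp]
    rfl

end HopfKernel

/-! ### The translation quiver of a commutative group and its Hopf bimodules. -/

section TranslationQuiver

variable {G : Type u} [CommGroup G] {J : Type v}

/-- The commutative group `G`, as the set of vertices of the quiver that has an arrow from `g` to
`g * w j` for all `g` in `G` and `j` in `J`. -/
def TranslationGroup (_w : J → G) : Type u := G

namespace TranslationGroup

variable (w : J → G)

instance : CommGroup (TranslationGroup w) := inferInstanceAs (CommGroup G)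

/-- The identity from `TranslationGroup w` to `G`. -/
def toGroup : TranslationGroup w ≃* G := MulEquiv.refl G

/-- The difference between the end and the start of the arrows with index `j`. -/
def weight (j : J) : TranslationGroup w := w j

/-- The type carries `w` so that this instance can depend on it. Indices with equal weights give
distinct parallel arrows, as will happen for `E i` and `F i`. -/
instance : Quiver.{v} (TranslationGroup w) := ⟨fun x y => {j : J // x * weight w j = y}⟩

/-- The arrow from `g` to `g * w j`. -/
def arrow (g : TranslationGroup w) (j : J) : Arrow (TranslationGroup w) :=
  ⟨g, g * weight w j, j, rfl⟩

@[simp] lemma src_arrow (g : TranslationGroup w) (j : J) : (arrow w g j).src = g := rfl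

@[simp] lemma tgt_arrow (g : TranslationGroup w) (j : J) : (arrow w g j).tgt = g * weight w j := rfl

/-- The index in `J` of an arrow. -/
def index (a : Arrow (TranslationGroup w)) : J := a.2.2.1

@[simp] lemma index_arrow (g : TranslationGroup w) (j : J) : index w (arrow w g j) = j := rfl

-- The end of an arrow is forced by its start and index, so arrows can be handled as pairs `(g, j)`
-- and no equation between vertices has to be transported.
variable {w} in
lemma exists_eq_arrow (a : Arrow (TranslationGroup w)) : ∃ g j, a = arrow w g j := by
  obtain ⟨g, _, j, rfl⟩ := a
  exact ⟨g, j, rfl⟩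

/-- The number of `j` with `w j` in a given conjugacy class. -/
def ramification (C : ConjClasses (TranslationGroup w)) : Cardinal.{v} :=
  Cardinal.mk {j : J // ConjClasses.mk (weight w j) = C}

/-- Commutativity reduces conjugacy to equality, and `x * w j = y` is the same condition as `w j =
x⁻¹ * y`. -/
lemma isHopfQuiver : IsHopfQuiver (TranslationGroup w) (ramification w) := by
  intro x y
  refine Cardinal.mk_congr (Equiv.subtypeEquivRight fun j => ?_)
  rw [ConjClasses.mk_eq_mk_iff_isConj, isConj_iff_eq]
  exact (eq_inv_mul_iff_mul_eq (a := weight w j) (b := x) (c := y)).symm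

variable {k : Type*} [CommRing k]

lemma arrowSpace_ext {P : Type*} [AddCommMonoid P] [Module k P]
    {f f' : ArrowSpace k (TranslationGroup w) →ₗ[k] P}
    (h : ∀ g j, f (Finsupp.single (arrow w g j) 1) = f' (Finsupp.single (arrow w g j) 1)) :
    f = f' := by
  refine Finsupp.lhom_ext' fun a => LinearMap.ext_ring ?_
  obtain ⟨g, j, rfl⟩ := exists_eq_arrow a
  exact h g j

/-- Translation by elements of the group, twisted by characters `χ j`. -/
noncomputable def twistedTranslation (χ : J → TranslationGroup w →* k) :
    TranslationGroup w →* Module.End k (ArrowSpace k (TranslationGroup w)) where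
  toFun g := Finsupp.linearCombination k fun a =>
    Finsupp.single (arrow w (g * a.src) (index w a)) (χ (index w a) g)
  map_one' := arrowSpace_ext w fun g j => by simp
  map_mul' g h := arrowSpace_ext w fun g' j => by simp [mul_assoc, mul_comm]

lemma twistedTranslation_single (χ : J → TranslationGroup w →* k) (g h : TranslationGroup w)
    (j : J) : twistedTranslation w χ g (Finsupp.single (arrow w h j) 1) =
      χ j g • Finsupp.single (arrow w (g * h) j) 1 := by
  simp [twistedTranslation]

lemma coactL_single (g : TranslationGroup w) (j : J) :
    arrowCoactL k _ (Finsupp.single (arrow w g j) 1) =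
      MonoidAlgebra.of k _ (g * weight w j) ⊗ₜ[k] Finsupp.single (arrow w g j) 1 := by
  simp [arrowCoactL]

lemma coactR_single (g : TranslationGroup w) (j : J) :
    arrowCoactR k _ (Finsupp.single (arrow w g j) 1) =
      Finsupp.single (arrow w g j) 1 ⊗ₜ[k] MonoidAlgebra.of k _ g := by
  simp [arrowCoactR]

/-- Translation by `g` multiplies the end of an arrow by `g`, and the character is a scalar that
moves into the second tensor factor. Because `G` is commutative, the same computation serves for the
left and for the right action. -/
lemma coactL_twistedTranslation (χ : J → TranslationGroup w →* k) (g : TranslationGroup w)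
    (m : ArrowSpace k (TranslationGroup w)) :
    arrowCoactL k _ (twistedTranslation w χ g m) =
      TensorProduct.map (LinearMap.mulLeft k (MonoidAlgebra.of k _ g))
        (twistedTranslation w χ g) (arrowCoactL k _ m) := by
  refine LinearMap.congr_fun (f := arrowCoactL k _ ∘ₗ twistedTranslation w χ g)
    (g := TensorProduct.map (LinearMap.mulLeft k (MonoidAlgebra.of k _ g))
      (twistedTranslation w χ g) ∘ₗ arrowCoactL k _) (arrowSpace_ext w fun h j => ?_) m
  rw [LinearMap.comp_apply, LinearMap.comp_apply, twistedTranslation_single, map_smul,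
    coactL_single, coactL_single, TensorProduct.map_tmul, LinearMap.mulLeft_apply,
    twistedTranslation_single, ← map_mul, mul_assoc, TensorProduct.tmul_smul]

lemma coactR_twistedTranslation (χ : J → TranslationGroup w →* k) (g : TranslationGroup w)
    (m : ArrowSpace k (TranslationGroup w)) :
    arrowCoactR k _ (twistedTranslation w χ g m) =
      TensorProduct.map (twistedTranslation w χ g)
        (LinearMap.mulLeft k (MonoidAlgebra.of k _ g)) (arrowCoactR k _ m) := by
  refine LinearMap.congr_fun (f := arrowCoactR k _ ∘ₗ twistedTranslation w χ g)
    (g := TensorProduct.map (twistedTranslation w χ g)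
      (LinearMap.mulLeft k (MonoidAlgebra.of k _ g)) ∘ₗ arrowCoactR k _)
    (arrowSpace_ext w fun h j => ?_) m
  rw [LinearMap.comp_apply, LinearMap.comp_apply, twistedTranslation_single, map_smul,
    coactR_single, coactR_single, TensorProduct.map_tmul, LinearMap.mulLeft_apply,
    twistedTranslation_single, ← map_mul, TensorProduct.smul_tmul']

lemma twistedTranslation_commute (χ χ' : J → TranslationGroup w →* k) (g h : TranslationGroup w) :
    Commute (twistedTranslation w χ g) (twistedTranslation w χ' h) := by
  refine arrowSpace_ext w fun g' j => ?_
  simp only [Module.End.mul_apply, twistedTranslation_single, map_smul, smul_smul, mul_comm (χ j g),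
    mul_left_comm g]

/-- The Hopf bimodule on the arrows on which `G` acts from the left by translation and from the
right by translation and the characters `χ j`. -/
noncomputable def hopfBimodule (χ : J → TranslationGroup w →* k) :
    ArrowHopfBimodule k (TranslationGroup w) where
  lact := MonoidAlgebra.lift k _ _ (twistedTranslation w fun _ => 1)
  -- The group algebra is commutative and so equal to its opposite, which turns the twisted left
  -- action into a right action.
  ract := (MonoidAlgebra.lift k _ _ (twistedTranslation w χ)).comp
    (AlgEquiv.toOpposite k (MonoidAlgebra k (TranslationGroup w))).symm
  lact_ract a b m := by
    -- Commuting is additive and homogeneous in both arguments, which leaves the case of two group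
    -- elements.
    have h : Commute (MonoidAlgebra.lift k _ _ (twistedTranslation w fun _ => 1) a)
        (MonoidAlgebra.lift k _ _ (twistedTranslation w χ) b.unop) := by
      induction a using MonoidAlgebra.induction_on with
      | of g =>
        induction b.unop using MonoidAlgebra.induction_on with
        | of h =>
          rw [MonoidAlgebra.lift_of, MonoidAlgebra.lift_of]
          exact twistedTranslation_commute w _ _ g h
        | add x y hx hy => rw [map_add]; exact hx.add_right hy
        | smul c x hx => rw [map_smul]; exact hx.smul_right c
      | add x y hx hy => rw [map_add]; exact hx.add_left hy
      | smul c x hx => rw [map_smul]; exact hx.smul_left c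
    exact LinearMap.congr_fun h m
  coactL_lact g m := by
    rw [MonoidAlgebra.lift_of]
    exact coactL_twistedTranslation w _ g m
  coactL_ract g m := by
    rw [show LinearMap.mulRight k (MonoidAlgebra.of k _ g) = LinearMap.mulLeft k _ from
      LinearMap.ext fun x => mul_comm x _]
    rw [show ((MonoidAlgebra.lift k _ _ (twistedTranslation w χ)).comp
      (AlgEquiv.toOpposite k (MonoidAlgebra k (TranslationGroup w))).symm.toAlgHom)
      (MulOpposite.op (MonoidAlgebra.of k _ g)) = twistedTranslation w χ g from
      MonoidAlgebra.lift_of _ g]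
    exact coactL_twistedTranslation w χ g m
  coactR_lact g m := by
    rw [MonoidAlgebra.lift_of]
    exact coactR_twistedTranslation w _ g m
  coactR_ract g m := by
    rw [show LinearMap.mulRight k (MonoidAlgebra.of k _ g) = LinearMap.mulLeft k _ from
      LinearMap.ext fun x => mul_comm x _]
    rw [show ((MonoidAlgebra.lift k _ _ (twistedTranslation w χ)).comp
      (AlgEquiv.toOpposite k (MonoidAlgebra k (TranslationGroup w))).symm.toAlgHom)
      (MulOpposite.op (MonoidAlgebra.of k _ g)) = twistedTranslation w χ g from
      MonoidAlgebra.lift_of _ g]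
    exact coactR_twistedTranslation w χ g m

lemma hopfBimodule_lact_of (χ : J → TranslationGroup w →* k) (g h : TranslationGroup w) (j : J) :
    (hopfBimodule w χ).lact (MonoidAlgebra.of k _ g) (Finsupp.single (arrow w h j) 1) =
      Finsupp.single (arrow w (g * h) j) 1 := by
  change MonoidAlgebra.lift k _ _ (twistedTranslation w fun _ => 1) _ _ = _
  rw [MonoidAlgebra.lift_of, twistedTranslation_single, MonoidHom.one_apply, one_smul]

lemma hopfBimodule_ract_of (χ : J → TranslationGroup w →* k) (g h : TranslationGroup w) (j : J) :
    (hopfBimodule w χ).ract (MulOpposite.op (MonoidAlgebra.of k _ g))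
      (Finsupp.single (arrow w h j) 1) = χ j g • Finsupp.single (arrow w (g * h) j) 1 := by
  change MonoidAlgebra.lift k _ _ (twistedTranslation w χ) (MonoidAlgebra.of k _ g) _ = _
  rw [MonoidAlgebra.lift_of, twistedTranslation_single]

end TranslationGroup

end TranslationQuiver

/-! ### Maps from the semi-path Hopf algebra, and quotients of it. -/

section Presentation

namespace TranslationGroup

variable {G : Type u} [CommGroup G] {J : Type v} (w : J → G) {k A : Type*} [CommRing k] [Ring A]

section Algebra

variable [Algebra k A] (χ : J → TranslationGroup w →* k) (φ : TranslationGroup w →* A) (y : J → A)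

/-- The linear map that sends the arrow from `g` to `g * w j` to `φ g * y j`. -/
noncomputable def arrowMap : ArrowSpace k (TranslationGroup w) →ₗ[k] A :=
  Finsupp.linearCombination k fun a => φ a.src * y (index w a)

lemma arrowMap_single (g : TranslationGroup w) (j : J) :
    arrowMap w φ y (Finsupp.single (arrow w g j) (1 : k)) = φ g * y j := by
  simp [arrowMap]

lemma arrowMap_lact (a : MonoidAlgebra k (TranslationGroup w))
    (m : ArrowSpace k (TranslationGroup w)) :
    arrowMap w φ y ((hopfBimodule w χ).lact a m) =
      MonoidAlgebra.lift k A _ φ a * arrowMap w φ y m := by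
  -- The identity is linear in `a` and in `m`, so it is enough to take a group element and an arrow.
  refine groupAlgebra_ext
    (f := arrowMap w φ y ∘ₗ LinearMap.flip (hopfBimodule w χ).lact.toLinearMap m)
    (f' := LinearMap.mulRight k (arrowMap w φ y m) ∘ₗ
      (MonoidAlgebra.lift k A _ φ).toLinearMap) (fun g => ?_) a
  refine LinearMap.congr_fun
    (f := arrowMap w φ y ∘ₗ (hopfBimodule w χ).lact (MonoidAlgebra.of k _ g))
    (g := LinearMap.mulLeft k (MonoidAlgebra.lift k A _ φ (MonoidAlgebra.of k _ g)) ∘ₗ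
      arrowMap w φ y) (arrowSpace_ext w fun g' j => ?_) m
  rw [LinearMap.comp_apply, LinearMap.comp_apply, hopfBimodule_lact_of, arrowMap_single,
    arrowMap_single, MonoidAlgebra.lift_of, LinearMap.mulLeft_apply, map_mul, mul_assoc]

-- Here the twist of the right action is accounted for: moving `φ g` to the left past `y j` produces
-- exactly the factor `χ j g`.
variable {χ φ y} in
lemma arrowMap_ract (h : ∀ j g, y j * φ g = χ j g • (φ g * y j))
    (m : ArrowSpace k (TranslationGroup w)) (a : MonoidAlgebra k (TranslationGroup w)) :
    arrowMap w φ y ((hopfBimodule w χ).ract (MulOpposite.op a) m) =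
      arrowMap w φ y m * MonoidAlgebra.lift k A _ φ a := by
  refine groupAlgebra_ext
    (f := arrowMap w φ y ∘ₗ LinearMap.flip (hopfBimodule w χ).ract.toLinearMap m ∘ₗ
      (MulOpposite.opLinearEquiv k).toLinearMap)
    (f' := LinearMap.mulLeft k (arrowMap w φ y m) ∘ₗ
      (MonoidAlgebra.lift k A _ φ).toLinearMap) (fun g => ?_) a
  refine LinearMap.congr_fun
    (f := arrowMap w φ y ∘ₗ
      (hopfBimodule w χ).ract (MulOpposite.op (MonoidAlgebra.of k _ g)))
    (g := LinearMap.mulRight k (MonoidAlgebra.lift k A _ φ (MonoidAlgebra.of k _ g)) ∘ₗ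
      arrowMap w φ y) (arrowSpace_ext w fun g' j => ?_) m
  rw [LinearMap.comp_apply, LinearMap.comp_apply, hopfBimodule_ract_of, map_smul,
    arrowMap_single, arrowMap_single, MonoidAlgebra.lift_of, LinearMap.mulRight_apply,
    mul_comm g, map_mul, mul_assoc, mul_assoc, h, mul_smul_comm]

/-- The algebra map on the semi-path algebra that is given by `φ` on the vertices and sends the
arrow from `g` to `g * w j` to `φ g * y j`. -/
noncomputable def semiPathLift (h : ∀ j g, y j * φ g = χ j g • (φ g * y j)) :
    SemiPath (hopfBimodule w χ) →ₐ[k] A :=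
  BimodTensor.lift (MonoidAlgebra.lift k A _ φ) (arrowMap w φ y) (arrowMap_lact w χ φ y)
    (arrowMap_ract w h)

variable {w χ φ y} (h : ∀ j g, y j * φ g = χ j g • (φ g * y j))

lemma semiPathLift_of (g : TranslationGroup w) :
    semiPathLift w χ φ y h (SemiPath.inclG _ (MonoidAlgebra.of k _ g)) = φ g := by
  rw [semiPathLift, BimodTensor.lift_inclB, MonoidAlgebra.lift_of]

lemma semiPathLift_arrow (g : TranslationGroup w) (j : J) :
    semiPathLift w χ φ y h (SemiPath.inclArrow _ (Finsupp.single (arrow w g j) 1)) =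
      φ g * y j := by
  rw [semiPathLift, BimodTensor.lift_inclM, arrowMap_single]

lemma semiPathLift_surjective (hA : Algebra.adjoin k (Set.range φ ∪ Set.range y) = ⊤) :
    Function.Surjective (semiPathLift w χ φ y h) := by
  rw [← AlgHom.range_eq_top, ← top_le_iff, ← hA, Algebra.adjoin_le_iff]
  rintro _ (⟨g, rfl⟩ | ⟨j, rfl⟩)
  · exact ⟨_, semiPathLift_of h g⟩
  -- The arrow with index `j` that starts at the identity maps to `y j` itself.
  · exact ⟨_, (semiPathLift_arrow h 1 j).trans (by rw [map_one, one_mul])⟩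

end Algebra

variable [HopfAlgebra k A] {w} {χ : J → TranslationGroup w →* k} {φ : TranslationGroup w →* A}
  {y : J → A}

/-- `semiPathLift` as a bialgebra map, for group-like elements `φ g` and skew-primitive
elements `y j`. -/
noncomputable def semiPathBialgHom (h : ∀ j g, y j * φ g = χ j g • (φ g * y j))
    (hφ : ∀ g, IsGroupLikeElem k (φ g))
    (hy : ∀ j, Coalgebra.comul (R := k) (y j) = φ (weight w j) ⊗ₜ y j + y j ⊗ₜ 1)
    (hy' : ∀ j, Coalgebra.counit (R := k) (y j) = 0) :
    SemiPath (hopfBimodule w χ) →ₐc[k] A :=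
  BialgHom.ofAlgHom (semiPathLift w χ φ y h)
    (by
      refine SemiPath.algHom_ext' _ (fun g => ?_) (fun a => ?_)
      · rw [AlgHom.comp_apply, semiPathLift_of]
        exact (hφ g).counit_eq_one.trans (SemiPath.counit_of _ g).symm
      · obtain ⟨g, j, rfl⟩ := exists_eq_arrow a
        rw [AlgHom.comp_apply, semiPathLift_arrow, map_mul]
        refine Eq.trans ?_ (SemiPath.counit_arrow _ _).symm
        exact (congrArg _ (hy' j)).trans (mul_zero _))
    (by
      refine SemiPath.algHom_ext' _ (fun g => ?_) (fun a => ?_)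
      · rw [AlgHom.comp_apply, AlgHom.comp_apply, semiPathLift_of, Bialgebra.comulAlgHom_apply,
          Bialgebra.comulAlgHom_apply, SemiPath.comul_of, Algebra.TensorProduct.map_tmul,
          semiPathLift_of, (hφ g).comul_eq_tmul_self]
      · obtain ⟨g, j, rfl⟩ := exists_eq_arrow a
        -- Multiplying `φ g ⊗ φ g` by `φ (w j) ⊗ y j + y j ⊗ 1` puts the end vertex `g * w j` on the
        -- left of the first term and the start vertex `g` on the right of the second.
        rw [AlgHom.comp_apply, AlgHom.comp_apply, semiPathLift_arrow, Bialgebra.comulAlgHom_apply,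
          Bialgebra.comulAlgHom_apply, SemiPath.comul_arrow, map_add,
          Algebra.TensorProduct.map_tmul, Algebra.TensorProduct.map_tmul, semiPathLift_of,
          semiPathLift_of, semiPathLift_arrow, Bialgebra.comul_mul, (hφ g).comul_eq_tmul_self, hy,
          mul_add, Algebra.TensorProduct.tmul_mul_tmul, Algebra.TensorProduct.tmul_mul_tmul,
          mul_one, tgt_arrow, src_arrow, map_mul])

/-- A Hopf algebra that is generated by a commutative group of group-like elements and by
skew-primitive elements on which the group acts through characters is a quotient of a semi-path
Hopf algebra by a Hopf ideal. -/
theorem exists_equiv_semiPath_quotient (h : ∀ j g, y j * φ g = χ j g • (φ g * y j))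
    (hφ : ∀ g, IsGroupLikeElem k (φ g))
    (hy : ∀ j, Coalgebra.comul (R := k) (y j) = φ (weight w j) ⊗ₜ y j + y j ⊗ₜ 1)
    (hy' : ∀ j, Coalgebra.counit (R := k) (y j) = 0)
    (hA : Algebra.adjoin k (Set.range φ ∪ Set.range y) = ⊤) :
    ∃ (I : Ideal (SemiPath (hopfBimodule w χ))) (_ : I.IsTwoSided) (_ : I.IsHopfIdeal k),
      Nonempty (A ≃ₐc[k] (SemiPath (hopfBimodule w χ) ⧸ I)) :=
  have hs : Function.Surjective (semiPathBialgHom h hφ hy hy') := semiPathLift_surjective h hA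
  have hI := isHopfIdeal_hopfKer _ hs
  ⟨hopfKer (semiPathBialgHom h hφ hy hy'), inferInstance, hI,
    nonempty_equiv_quotient_hopfKer _ hs⟩

end TranslationGroup

end Presentation

/-! ### Group-like and skew-primitive generators of the quantum enveloping algebra. -/

section QuantumGroup

namespace QuantumEnveloping

open TranslationGroup

variable {k : Type*} [Field k] {ι : Type u} (c : CartanDatum ι) (q : kˣ) (hq : ¬ IsOfFinOrder q)

/-- The generator `K i` as a unit. -/
noncomputable def unitK (i : ι) : (QuantumEnveloping c q hq)ˣ :=
  ⟨K c q hq i, Kinv c q hq i, (relations c q hq).K_Kinv i, (relations c q hq).Kinv_K i⟩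

/-- The free abelian group on `ι`, written multiplicatively. -/
abbrev Torus (ι : Type u) : Type u := Abelianization (FreeGroup ι)

/-- The generators of the free abelian group. -/
def torusGen (i : ι) : Torus ι := Abelianization.of (FreeGroup.of i)

/-- Induction on words in the free group, pushed along the surjection to its abelianization. -/
lemma torus_induction {p : Torus ι → Prop} (one : p 1) (gen : ∀ i, p (torusGen i))
    (inv : ∀ g, p g → p g⁻¹) (mul : ∀ g h, p g → p h → p (g * h)) (g : Torus ι) : p g := by
  obtain ⟨x, rfl⟩ := QuotientGroup.mk_surjective g
  exact FreeGroup.induction_on (C := fun x => p (Abelianization.of x)) x one gen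
    (fun i => inv _) (fun x y => mul _ _)

open scoped IsMulCommutative in
/-- The homomorphism from the free abelian group that sends the generators to the `K i`. -/
noncomputable def torusHom : Torus ι →* (QuantumEnveloping c q hq)ˣ :=
  -- A map out of the abelianization needs a commutative target. The unit group of `U_q` need not be
  -- one, so the map is built into the subgroup generated by the `K i`, which commute, and then
  -- followed by the inclusion.
  haveI : IsMulCommutative (Subgroup.closure (Set.range (unitK c q hq))) :=
    Subgroup.isMulCommutative_closure (by
      rintro _ ⟨i, rfl⟩ _ ⟨j, rfl⟩
      exact Units.ext ((relations c q hq).K_K i j))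
  (Subgroup.subtype _).comp (Abelianization.lift (FreeGroup.lift fun i =>
    (⟨unitK c q hq i, Subgroup.subset_closure ⟨i, rfl⟩⟩ :
      Subgroup.closure (Set.range (unitK c q hq)))))

lemma torusHom_gen (i : ι) : torusHom c q hq (torusGen i) = unitK c q hq i := by
  simp [torusHom, torusGen]

/-- The character of the free abelian group with `K i ↦ s i`. -/
noncomputable def torusChar (s : ι → kˣ) : Torus ι →* kˣ := Abelianization.lift (FreeGroup.lift s)

lemma torusChar_gen (s : ι → kˣ) (i : ι) : torusChar s (torusGen i) = s i := by
  simp [torusChar, torusGen]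

/-- An element that commutes with the `K i` up to scalars does so with all products of them. -/
lemma mul_torusHom {x : QuantumEnveloping c q hq} {s : ι → kˣ}
    (h : ∀ i, x * K c q hq i = (s i : k) • (K c q hq i * x)) (g : Torus ι) :
    x * (torusHom c q hq g : QuantumEnveloping c q hq) =
      (torusChar s g : k) • ((torusHom c q hq g : QuantumEnveloping c q hq) * x) := by
  induction g using torus_induction with
  | one => simp
  | gen i => rw [torusHom_gen, torusChar_gen]; exact h i
  | inv g hg =>
    -- `swap_inv` expects the relation with the group element on the left, so the induction
    -- hypothesis is used in reverse, with the inverse scalar.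
    refine QRelations.swap_inv (a := (torusHom c q hq g : QuantumEnveloping c q hq)) ?_ ?_ ?_
    · rw [map_inv, Units.mul_inv]
    · rw [map_inv, Units.inv_mul]
    · rw [hg, smul_smul, ← Units.val_mul, ← map_mul, inv_mul_cancel, map_one, Units.val_one,
        one_smul]
  | mul g g' hg hg' =>
    rw [map_mul, map_mul, Units.val_mul, Units.val_mul, ← mul_assoc, hg, smul_mul_assoc, mul_assoc,
      hg', mul_smul_comm, smul_smul, mul_assoc]

lemma isGroupLikeElem_K (i : ι) : IsGroupLikeElem k (K c q hq i) :=
  ⟨counit_K c q hq i, comul_K c q hq i⟩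

lemma isGroupLikeElem_torusHom (g : Torus ι) :
    IsGroupLikeElem k (torusHom c q hq g : QuantumEnveloping c q hq) := by
  induction g using torus_induction with
  | one => rw [map_one, Units.val_one]; exact .one
  | gen i => rw [torusHom_gen]; exact isGroupLikeElem_K c q hq i
  | inv g hg =>
    rw [map_inv]
    exact hg.of_mul_eq_one (Units.mul_inv _) (Units.inv_mul _)
  | mul g g' hg hg' => rw [map_mul, Units.val_mul]; exact hg.mul hg'

/-- The skew-primitive elements `E i * K i` and `F i * K i`. -/
noncomputable def skewPrim : ι ⊕ ι → QuantumEnveloping c q hq :=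
  Sum.elim (fun i => E c q hq i * K c q hq i) (fun i => F c q hq i * K c q hq i)

/-- The weight of `E i * K i` and of `F i * K i`. -/
def skewWeight : ι ⊕ ι → Torus ι := Sum.elim (fun i => torusGen i ^ 2) (fun i => torusGen i ^ 2)

/-- The scalar `q ^ (d i * a i j)` as a unit. -/
def scalUnit (i j : ι) : kˣ := q ^ ((c.d i : ℤ) * c.A i j)

/-- The characters through which the `K i` commute with `E j * K j` and `F j * K j`. -/
noncomputable def skewChar : ι ⊕ ι → Torus ι →* kˣ :=
  Sum.elim (fun j => torusChar fun i => (scalUnit c q i j)⁻¹)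
    (fun j => torusChar fun i => scalUnit c q i j)

/-- It suffices to test on the `K i`. These commute with the factor `K j`, so only the scalar from
`E j` or `F j` remains, inverted because `K i` is moved from right to left. -/
lemma skewPrim_mul_torusHom (j : ι ⊕ ι) (g : Torus ι) :
    skewPrim c q hq j * (torusHom c q hq g : QuantumEnveloping c q hq) =
      (skewChar c q j g : k) •
        ((torusHom c q hq g : QuantumEnveloping c q hq) * skewPrim c q hq j) := by
  have H := relations c q hq
  rcases j with j | j
  · refine mul_torusHom c q hq (fun i => ?_) g
    rw [skewPrim, Sum.elim_inl, ← mul_assoc, H.K_E, smul_mul_assoc, smul_smul, mul_assoc, mul_assoc, H.K_K,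
      Units.val_inv_eq_inv_val]
    -- `scalUnit` coerces to `c.scal` by definition, so the scalar from the relation cancels that of
    -- the character.
    exact (one_smul k _).symm.trans (congrArg (· • _) (inv_mul_cancel₀ (c.scal_ne_zero q i j)).symm)
  · refine mul_torusHom c q hq (fun i => ?_) g
    rw [skewPrim, Sum.elim_inr, ← mul_assoc, H.K_F, smul_mul_assoc, smul_smul, mul_assoc, mul_assoc, H.K_K]
    exact (one_smul k _).symm.trans (congrArg (· • _) (mul_inv_cancel₀ (c.scal_ne_zero q i j)).symm)

/-- The factor `K j` is there for this: multiplying `X ⊗ K j⁻¹ + K j ⊗ X` by `K j ⊗ K j` turns `K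
j⁻¹` into `1` and `K j` into `K j ^ 2`. -/
lemma comul_skewPrim (j : ι ⊕ ι) : Coalgebra.comul (R := k) (skewPrim c q hq j) =
    (torusHom c q hq (skewWeight j) : QuantumEnveloping c q hq) ⊗ₜ skewPrim c q hq j +
      skewPrim c q hq j ⊗ₜ 1 := by
  have H := relations c q hq
  rcases j with j | j
  · simp only [skewPrim, skewWeight, Sum.elim_inl, Bialgebra.comul_mul, comul_E, comul_K, add_mul,
      Algebra.TensorProduct.tmul_mul_tmul, H.Kinv_K, map_pow, torusHom_gen, Units.val_pow_eq_pow_val]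
    rw [add_comm, sq]
    rfl
  · simp only [skewPrim, skewWeight, Sum.elim_inr, Bialgebra.comul_mul, comul_F, comul_K, add_mul,
      Algebra.TensorProduct.tmul_mul_tmul, H.Kinv_K, map_pow, torusHom_gen, Units.val_pow_eq_pow_val]
    rw [add_comm, sq]
    rfl

lemma counit_skewPrim (j : ι ⊕ ι) : Coalgebra.counit (R := k) (skewPrim c q hq j) = 0 := by
  rcases j with j | j
  · simp only [skewPrim, Sum.elim_inl, Bialgebra.counit_mul, counit_E, zero_mul]
  · simp only [skewPrim, Sum.elim_inr, Bialgebra.counit_mul, counit_F, zero_mul]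

lemma adjoin_torusHom_skewPrim : Algebra.adjoin k
    (Set.range (fun g => (torusHom c q hq g : QuantumEnveloping c q hq)) ∪
      Set.range (skewPrim c q hq)) = ⊤ := by
  have H := relations c q hq
  rw [← top_le_iff, ← adjoin_gens c q hq, Algebra.adjoin_le_iff]
  have hT : ∀ g, (torusHom c q hq g : QuantumEnveloping c q hq) ∈ Algebra.adjoin k
      (Set.range (fun g => (torusHom c q hq g : QuantumEnveloping c q hq)) ∪
        Set.range (skewPrim c q hq)) := fun g => Algebra.subset_adjoin (Or.inl ⟨g, rfl⟩)
  have hS : ∀ j, skewPrim c q hq j ∈ Algebra.adjoin k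
      (Set.range (fun g => (torusHom c q hq g : QuantumEnveloping c q hq)) ∪
        Set.range (skewPrim c q hq)) := fun j => Algebra.subset_adjoin (Or.inr ⟨j, rfl⟩)
  have hK : ∀ i, (torusHom c q hq (torusGen i) : QuantumEnveloping c q hq) = K c q hq i :=
    fun i => by rw [torusHom_gen]; rfl
  have hK' : ∀ i, (torusHom c q hq (torusGen i)⁻¹ : QuantumEnveloping c q hq) = Kinv c q hq i :=
    fun i => by rw [map_inv, torusHom_gen]; rfl
  rintro _ ⟨i | i | i | i, rfl⟩
  -- `E i` is recovered as `(E i * K i) * K i⁻¹`; the same works for `F i`.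
  · have h := mul_mem (hS (.inl i)) (hT (torusGen i)⁻¹)
    rwa [hK', skewPrim, Sum.elim_inl, mul_assoc, H.K_Kinv, mul_one] at h
  · have h := mul_mem (hS (.inr i)) (hT (torusGen i)⁻¹)
    rwa [hK', skewPrim, Sum.elim_inr, mul_assoc, H.K_Kinv, mul_one] at h
  · have h := hT (torusGen i)
    rwa [hK] at h
  · have h := hT (torusGen i)⁻¹
    rwa [hK'] at h

/-- The quantum enveloping algebra is a quotient of a semi-path Hopf algebra by a Hopf ideal. -/
theorem exists_equiv_semiPath_quotient :
    ∃ (G : Type u) (_ : Group G) (_ : Quiver.{u} G) (r : ConjClasses G → Cardinal.{u})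
      (_ : IsHopfQuiver G r) (N : ArrowHopfBimodule k G) (I : Ideal (SemiPath N))
      (_ : I.IsTwoSided) (_ : I.IsHopfIdeal k),
      Nonempty (QuantumEnveloping c q hq ≃ₐc[k] (SemiPath N ⧸ I)) := by
  let w : ι ⊕ ι → Torus ι := skewWeight
  exact ⟨TranslationGroup w, inferInstance, inferInstance, ramification w, isHopfQuiver w,
    -- `toGroup w` is the identity map. It carries the characters and `torusHom` to the type with
    -- the quiver structure, and the lemmas about `Torus ι` then apply by unfolding definitions.
    hopfBimodule w fun j => (Units.coeHom k).comp ((skewChar c q j).comp (toGroup w).toMonoidHom),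
    TranslationGroup.exists_equiv_semiPath_quotient
      (φ := (Units.coeHom _).comp ((torusHom c q hq).comp (toGroup w).toMonoidHom))
      (y := skewPrim c q hq)
      (skewPrim_mul_torusHom c q hq) (isGroupLikeElem_torusHom c q hq) (comul_skewPrim c q hq)
      (counit_skewPrim c q hq) (adjoin_torusHom_skewPrim c q hq)⟩

end QuantumEnveloping

end QuantumGroup

end QuiverHopf


/-! ### The case of a complex semisimple Lie algebra. -/

open LieAlgebra.IsKilling QuiverHopf in
/-- The quantum enveloping algebra `U_q(L)` of a complex semisimple Lie algebra `L`, with Cartan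
matrix `A i j = ⟨α_j, α_i^∨⟩` and `q ≠ 0` not a root of unity, is isomorphic as a Hopf algebra to the
quotient of a semi-path Hopf algebra `T_{ℂG}(ℂQ₁)` by a Hopf ideal. -/
theorem corollary3p10 {L : Type u} [LieRing L] [LieAlgebra ℂ L] [FiniteDimensional ℂ L]
    [LieAlgebra.IsSemisimple ℂ L] (H : LieSubalgebra ℂ L) [H.IsCartanSubalgebra]
    (b : (rootSystem H).Base) (c : CartanDatum b.support)
    (hA : c.A = b.cartanMatrix.transpose) (hd : ∀ i, c.d i ∈ ({1, 2, 3} : Set ℕ))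
    (q : ℂˣ) (hq : ¬ IsOfFinOrder q) :
    ∃ (G : Type u) (_ : Group G) (_ : Quiver.{u} G) (r : ConjClasses G → Cardinal.{u})
      (_ : IsHopfQuiver G r) (N : ArrowHopfBimodule ℂ G) (I : Ideal (SemiPath N))
      (_ : I.IsTwoSided) (_ : I.IsHopfIdeal ℂ),
      Nonempty (QuantumEnveloping c q hq ≃ₐc[ℂ] (SemiPath N ⧸ I)) := by
  exact QuantumEnveloping.exists_equiv_semiPath_quotient c q hq
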